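/- \textbf{Setting.} \emph{PCF} is the simply typed $\lambda$-calculus with types $\mathbb B,\mathbb N,\mathrm{list}_\tau,\tau\times\sigma,\tau\to\sigma$, pairs, projections, constructors, case analysis, and recursive definitions $\mathrm{letrec}\,f\,x=e$ over $\mathbb N$ or lists in which $f$ is only called on strict structural parts of $x$; $=_{\beta\iota\mu}$ is its conversion. \emph{HOL} ($\Gamma\mid\Psi\vdash\phi$) is intuitionistic natural deduction over PCF terms with equality ($=_{\beta\iota\mu}$, substitution of equals), induction, non-overlap and injectivity of constructors, and a predicate $\mathsf{listU}(n,x,P)$ with axioms $\mathsf{listU}(0,x,P)\Leftrightarrow x=[]$ and $\mathsf{listU}(n+1,x,P)\Leftrightarrow\exists w_1w_2.\,x=w_1::w_2\wedge P(w_1)\wedge\mathsf{listU}(n,w_2,P)$; $a\le b$ means $\exists d.\,a+d=b$. \emph{UHOL} is the calculus of judgments $\Gamma\mid\Psi\vdash t:\tau\mid\phi$, where $\phi$ may mention $t$ through the distinguished variable $\mathbf r$; it has one rule for each term constructor of PCF and the subsumption rule deriving $\phi$ from $\phi'$ when $\Gamma\mid\Psi\vdash\phi'[t/\mathbf r]\Rightarrow\phi[t/\mathbf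 r]$ in HOL. \emph{RelCost unary types} are $A::=\mathbb N\mid\mathrm{list}\,A[n]\mid A\xrightarrow{\mathrm{exec}(k,l)}A\mid\forall i.^{\mathrm{exec}(k,l)}A$, where $n,k$ are index terms (PCF terms of type $\mathbb N$ over the index variables), and $l$ is an index term or $\infty$. \emph{Expressions} are $x$, numerals, $\lambda x.t$, $t\,u$, $\Lambda.t$, $t[\,]$, $\mathsf{nil}$, $\mathsf{cons}(t,u)$ and $\mathsf{case}\ t\ \mathsf{of}\ \mathsf{nil}\to t_1\mid h::tl\to t_2$, simply typed through the erasure $|\mathbb N|=\mathbb N$, $|\mathrm{list}\,A[n]|=\mathrm{list}_{|A|}$, $|A\xrightarrow{\mathrm{exec}(k,l)}B|=|A|\to|B|$, $|\forall i.^{\mathrm{exec}(k,l)}A|=\mathbb N\to|A|$. The judgment $\Delta;\Phi;\Omega\vdash_k^l t:A$ ($\Delta$: index variables, each ranging over $\mathbb N$; $\Phi$: assertions over $\Delta$; $\Omega$: types of the program variables) is generated by the following rules, where $c_{app},c_{iapp},c_{case}\in\mathbb N$ are fixed, $\Delta,\Phi,\Omega$ are omitted where unchanged, and addition of upper bounds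 is extended by $\infty$. \begin{itemize} \item $\vdash_0^0x:\Omega(x)$; $\vdash_0^0 m:\mathbb N$ for numerals $m$; $\vdash_0^0\mathsf{nil}:\mathrm{list}\,A[0]$. \item If $\Omega,x:A\vdash_k^l t:B$, then $\vdash_0^0\lambda x.t:A\xrightarrow{\mathrm{exec}(k,l)}B$. \item If $\vdash_{k_1}^{l_1}t_1:A\xrightarrow{\mathrm{exec}(k,l)}B$ and $\vdash_{k_2}^{l_2}t_2:A$, then $\vdash_{k_1+k_2+k+c_{app}}^{l_1+l_2+l+c_{app}}t_1\,t_2:B$. \item If $i,\Delta\vdash_k^l t:A$ with $i$ not free in $\Phi,\Omega$, then $\vdash_0^0\Lambda.t:\forall i.^{\mathrm{exec}(k,l)}A$. \item If $\vdash_k^l t:\forall i.^{\mathrm{exec}(k',l')}A$ and $J$ is an index term, then $\vdash_{k+k'[J/i]+c_{iapp}}^{l+l'[J/i]+c_{iapp}}t[\,]:A[J/i]$. \item If $\vdash_{k_1}^{l_1}t_1:A$ and $\vdash_{k_2}^{l_2}t_2:\mathrm{list}\,A[n]$, then $\vdash_{k_1+k_2}^{l_1+l_2}\mathsf{cons}(t_1,t_2):\mathrm{list}\,A[n+1]$.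 \item If $\vdash_k^l t:\mathrm{list}\,A[n]$, and $\vdash_{k'}^{l'}t_1:B$ under the additional assumption $n=0$, and $\vdash_{k'}^{l'}t_2:B$ with a fresh index variable $i$, the additional assumption $n=i+1$, and $h:A$, $tl:\mathrm{list}\,A[i]$, then $\vdash_{k+k'+c_{case}}^{l+l'+c_{case}}\mathsf{case}\ t\ \mathsf{of}\ \mathsf{nil}\to t_1\mid h::tl\to t_2:B$. \item Subsumption: from $\vdash_k^l t:A$, $A\sqsubseteq A'$, $k'\le k$, $l\le l'$ conclude $\vdash_{k'}^{l'}t:A'$. Here $\sqsubseteq$ is the reflexive transitive relation that is covariant for lists with provably equal sizes, contravariant in arguments and covariant in results of arrows, covariant for $\forall$, and widens the interval $[k,l]$ of effects. \item Case split on a disjunction of assertions provable from $\Phi$; and $\vdash_k^l t:A$ for every expression $t$ of simple type $|A|$ if $\Phi$ is contradictory. \end{itemize} All entailments of assertions over $\Delta$ in these rules are HOL derivability $\Delta\mid\Phi\vdash\cdot$. \textbf{Translations.} On simple types, $\|\mathbb N\|_v=\mathbb N$, $\|\mathrm{list}_\sigma\|_v=\mathrm{list}_{\|\sigma\|_v}$,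 $\|\sigma\to\tau\|_v=\|\sigma\|_v\to\|\tau\|_e$, $\|\sigma\|_e=\|\sigma\|_v\times\mathbb N$. On expressions, \begin{align*} \|x\|&=(x,0),\quad \|m\|=(m,0),\quad \|\lambda x.t\|=(\lambda x.\|t\|,0),\quad \|\Lambda.t\|=(\lambda\_.\|t\|,0),\quad \|\mathsf{nil}\|=([],0),\\ \|t\,u\|&=\mathsf{let}\ x=\|t\|\ \mathsf{in}\ \mathsf{let}\ y=\|u\|\ \mathsf{in}\ \mathsf{let}\ z=\pi_1x\;\pi_1y\ \mathsf{in}\ (\pi_1z,\ \pi_2x+\pi_2y+\pi_2z+c_{app}),\\ \|t[\,]\|&=\mathsf{let}\ x=\|t\|\ \mathsf{in}\ \mathsf{let}\ y=\pi_1x\;0\ \mathsf{in}\ (\pi_1y,\ \pi_2x+\pi_2y+c_{iapp}),\\ \|\mathsf{cons}(t,u)\|&=\mathsf{let}\ x=\|t\|\ \mathsf{in}\ \mathsf{let}\ y=\|u\|\ \mathsf{in}\ (\pi_1x::\pi_1y,\ \pi_2x+\pi_2y), \end{align*} and $\|\mathsf{case}\ t\ \mathsf{of}\ \mathsf{nil}\to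 t_1\mid h::tl\to t_2\|$ is $\mathsf{let}\ x=\|t\|$ followed by case analysis on $\pi_1x$ with branches $\mathsf{let}\ y=\|t_j\|\ \mathsf{in}\ (\pi_1y,\ \pi_2x+\pi_2y+c_{case})$. On unary types, \begin{align*} \lfloor\mathbb N\rfloor_v(x)&=\top,\qquad \lfloor\mathrm{list}\,A[n]\rfloor_v(x)=\mathsf{listU}(n,x,\lfloor A\rfloor_v),\\ \lfloor A\xrightarrow{\mathrm{exec}(k,l)}B\rfloor_v(x)&=\forall y.\,\lfloor A\rfloor_v(y)\Rightarrow\lfloor B\rfloor_e^{k,l}(x\,y),\\ \lfloor\forall i.^{\mathrm{exec}(k,l)}A\rfloor_v(x)&=\forall y.\,\top\Rightarrow\forall i.\,\lfloor A\rfloor_e^{k,l}(x\,y),\\ \lfloor A\rfloor_e^{k,l}(x)&=\lfloor A\rfloor_v(\pi_1x)\wedge k\le\pi_2x\le l\qquad(\pi_2x\le\infty\text{ is }\top). \end{align*} For $\Omega=x_1:A_1,\dots,x_n:A_n$ let $\||\Omega|\|=x_1:\||A_1|\|_v,\dots,x_n:\||A_n|\|_v$ and $\lfloor\Omega\rfloor=\lfloor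 A_1\rfloor_v(x_1),\dots,\lfloor A_n\rfloor_v(x_n)$. \textbf{Theorem.} If $\Delta;\Phi;\Omega\vdash_k^l t:A$, then UHOL derives $$\||\Omega|\|,\Delta\ \mid\ \Phi,\lfloor\Omega\rfloor\ \vdash\ \|t\|:\||A|\|_e\ \mid\ \lfloor A\rfloor_e^{k,l}(\mathbf r).$$ -/

import Mathlib

namespace RelCost

/-! ## PCF: types, terms, substitution -/

/-- Simple types of PCF. -/
inductive Ty : Type
  | bool | nat
  | list (τ : Ty)
  | prod (σ τ : Ty)
  | arr (σ τ : Ty)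

/-- Contexts; the head is the most recently bound variable. -/
abbrev Ctx := List Ty

/-- Typed de Bruijn variables. -/
inductive Var {α : Type} : List α → α → Type
  | z {Γ : List α} {τ : α} : Var (τ :: Γ) τ
  | s {Γ : List α} {τ σ : α} : Var Γ τ → Var (σ :: Γ) τ

/-- Inductive types that may be the domain of a recursive definition: `ℕ` and lists. -/
inductive Ind : Ty → Type
  | nat : Ind Ty.nat
  | list (τ : Ty) : Ind (Ty.list τ)

/-- `Tm Γ τ` is the type of terms `t` with `Γ ⊢ t : τ` (Church style; terms are identified up to
renaming of bound variables).  In `letrec hI e` the body `e` has variable `0` for the argument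
`x : I` and variable `1` for the function `f : I → σ`.  The guard condition on recursive
definitions is imposed where such definitions are used: in the `μ`-rule and in the
`letrec` rule of unary higher-order logic.  A `letrec` violating it does not reduce. -/
inductive Tm : Ctx → Ty → Type
  | var {Γ τ} (x : Var Γ τ) : Tm Γ τ
  | pair {Γ σ τ} (t : Tm Γ σ) (u : Tm Γ τ) : Tm Γ (Ty.prod σ τ)
  | fst {Γ σ τ} (t : Tm Γ (Ty.prod σ τ)) : Tm Γ σ
  | snd {Γ σ τ} (t : Tm Γ (Ty.prod σ τ)) : Tm Γ τ
  | app {Γ σ τ} (t : Tm Γ (Ty.arr σ τ)) (u : Tm Γ σ) : Tm Γ τ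
  | lam {Γ σ τ} (t : Tm (σ :: Γ) τ) : Tm Γ (Ty.arr σ τ)
  | tt {Γ} : Tm Γ Ty.bool
  | ff {Γ} : Tm Γ Ty.bool
  | zero {Γ} : Tm Γ Ty.nat
  | nil {Γ τ} : Tm Γ (Ty.list τ)
  | succ {Γ} (t : Tm Γ Ty.nat) : Tm Γ Ty.nat
  | cons {Γ τ} (t : Tm Γ τ) (u : Tm Γ (Ty.list τ)) : Tm Γ (Ty.list τ)
  | caseNat {Γ τ} (t : Tm Γ Ty.nat) (u : Tm Γ τ) (v : Tm Γ (Ty.arr Ty.nat τ)) : Tm Γ τ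
  | caseBool {Γ τ} (t : Tm Γ Ty.bool) (u v : Tm Γ τ) : Tm Γ τ
  | caseList {Γ σ τ} (t : Tm Γ (Ty.list σ)) (u : Tm Γ τ)
      (v : Tm Γ (Ty.arr σ (Ty.arr (Ty.list σ) τ))) : Tm Γ τ
  | letrec {Γ I σ} (hI : Ind I) (e : Tm (I :: Ty.arr I σ :: Γ) σ) : Tm Γ (Ty.arr I σ)

/-- Renamings. -/
abbrev Ren (Γ Δ : Ctx) := ∀ ⦃τ : Ty⦄, Var Γ τ → Var Δ τ

def Ren.lift {Γ Δ : Ctx} {σ : Ty} (r : Ren Γ Δ) : Ren (σ :: Γ) (σ :: Δ)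
  | _, .z => .z
  | _, .s x => .s (r x)

def Tm.rename : ∀ {Γ : Ctx} {τ : Ty}, Tm Γ τ → ∀ {Δ : Ctx}, Ren Γ Δ → Tm Δ τ
  | _, _, .var x, _, r => .var (r x)
  | _, _, .pair t u, _, r => .pair (t.rename r) (u.rename r)
  | _, _, .fst t, _, r => .fst (t.rename r)
  | _, _, .snd t, _, r => .snd (t.rename r)
  | _, _, .app t u, _, r => .app (t.rename r) (u.rename r)
  | _, _, .lam t, _, r => .lam (t.rename r.lift)
  | _, _, .tt, _, _ => .tt
  | _, _, .ff, _, _ => .ff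
  | _, _, .zero, _, _ => .zero
  | _, _, .nil, _, _ => .nil
  | _, _, .succ t, _, r => .succ (t.rename r)
  | _, _, .cons t u, _, r => .cons (t.rename r) (u.rename r)
  | _, _, .caseNat t u v, _, r => .caseNat (t.rename r) (u.rename r) (v.rename r)
  | _, _, .caseBool t u v, _, r => .caseBool (t.rename r) (u.rename r) (v.rename r)
  | _, _, .caseList t u v, _, r => .caseList (t.rename r) (u.rename r) (v.rename r)
  | _, _, .letrec hI e, _, r => .letrec hI (e.rename r.lift.lift)

/-- Weakening by one variable. -/
def Tm.wk {Γ : Ctx} {σ τ : Ty} (t : Tm Γ τ) : Tm (σ :: Γ) τ := t.rename (fun _ x => .s x)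

/-- Simultaneous (capture-free) substitutions. -/
abbrev Sub (Γ Δ : Ctx) := ∀ ⦃τ : Ty⦄, Var Γ τ → Tm Δ τ

def Sub.lift {Γ Δ : Ctx} {σ : Ty} (s : Sub Γ Δ) : Sub (σ :: Γ) (σ :: Δ)
  | _, .z => .var .z
  | _, .s x => (s x).wk

/-- The substitution `s` extended by mapping the most recent variable to `t`. -/
def Sub.cons {Γ Δ : Ctx} {σ : Ty} (s : Sub Γ Δ) (t : Tm Δ σ) : Sub (σ :: Γ) Δ
  | _, .z => t
  | _, .s x => s x

def Sub.ofRen {Γ Δ : Ctx} (r : Ren Γ Δ) : Sub Γ Δ := fun _ x => .var (r x)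

/-- Replace the most recent variable by `t`, and leave the others. -/
def Sub.one {Γ : Ctx} {σ : Ty} (t : Tm Γ σ) : Sub (σ :: Γ) Γ := Sub.cons (fun _ x => .var x) t

/-- All terms of the substitution are weakened by one variable. -/
def Sub.wk {Γ Δ : Ctx} {σ : Ty} (s : Sub Γ Δ) : Sub Γ (σ :: Δ) := fun _ x => (s x).wk

def Tm.subst : ∀ {Γ : Ctx} {τ : Ty}, Tm Γ τ → ∀ {Δ : Ctx}, Sub Γ Δ → Tm Δ τ
  | _, _, .var x, _, s => s x
  | _, _, .pair t u, _, s => .pair (t.subst s) (u.subst s)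
  | _, _, .fst t, _, s => .fst (t.subst s)
  | _, _, .snd t, _, s => .snd (t.subst s)
  | _, _, .app t u, _, s => .app (t.subst s) (u.subst s)
  | _, _, .lam t, _, s => .lam (t.subst s.lift)
  | _, _, .tt, _, _ => .tt
  | _, _, .ff, _, _ => .ff
  | _, _, .zero, _, _ => .zero
  | _, _, .nil, _, _ => .nil
  | _, _, .succ t, _, s => .succ (t.subst s)
  | _, _, .cons t u, _, s => .cons (t.subst s) (u.subst s)
  | _, _, .caseNat t u v, _, s => .caseNat (t.subst s) (u.subst s) (v.subst s)
  | _, _, .caseBool t u v, _, s => .caseBool (t.subst s) (u.subst s) (v.subst s)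
  | _, _, .caseList t u v, _, s => .caseList (t.subst s) (u.subst s) (v.subst s)
  | _, _, .letrec hI e, _, s => .letrec hI (e.subst s.lift.lift)

/-! ## The guard condition: recursive calls only on structurally smaller arguments -/

/-- Role of a variable inside the body of `letrec f x = e`: the function `f`, the argument `x`,
a strict structural part of `x` of the same type, or none of these. -/
inductive Role : Type
  | plain | fn | arg | small

abbrev Roles (Γ : Ctx) := ∀ ⦃τ : Ty⦄, Var Γ τ → Role

def Roles.ext {Γ : Ctx} {σ : Ty} (R : Roles Γ) (r : Role) : Roles (σ :: Γ)
  | _, .z => r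
  | _, .s x => R x

/-- `Guard R e`: the recursive function occurs in `e` only applied to variables that denote strict
parts of the argument.  Such variables are bound by case analysis on the argument or on
one of its strict parts. -/
inductive Guard : ∀ {Γ : Ctx} {τ : Ty}, Roles Γ → Tm Γ τ → Prop
  | var {Γ τ} {R : Roles Γ} {x : Var Γ τ} (h : R x ≠ Role.fn) : Guard R (Tm.var x)
  | call {Γ I σ} {R : Roles Γ} {f : Var Γ (Ty.arr I σ)} {y : Var Γ I}
      (hf : R f = Role.fn) (hy : R y = Role.small) : Guard R (Tm.app (Tm.var f) (Tm.var y))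
  | caseNatSmall {Γ τ} {R : Roles Γ} {y : Var Γ Ty.nat} {u : Tm Γ τ} {v : Tm (Ty.nat :: Γ) τ}
      (hy : R y = Role.arg ∨ R y = Role.small) (hu : Guard R u)
      (hv : Guard (R.ext Role.small) v) : Guard R (Tm.caseNat (Tm.var y) u (Tm.lam v))
  | caseListSmall {Γ σ τ} {R : Roles Γ} {y : Var Γ (Ty.list σ)} {u : Tm Γ τ}
      {v : Tm (Ty.list σ :: σ :: Γ) τ}
      (hy : R y = Role.arg ∨ R y = Role.small) (hu : Guard R u)
      (hv : Guard ((R.ext Role.plain).ext Role.small) v) :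
      Guard R (Tm.caseList (Tm.var y) u (Tm.lam (Tm.lam v)))
  | pair {Γ σ τ} {R : Roles Γ} {t : Tm Γ σ} {u : Tm Γ τ} (ht : Guard R t) (hu : Guard R u) :
      Guard R (Tm.pair t u)
  | fst {Γ σ τ} {R : Roles Γ} {t : Tm Γ (Ty.prod σ τ)} (ht : Guard R t) : Guard R (Tm.fst t)
  | snd {Γ σ τ} {R : Roles Γ} {t : Tm Γ (Ty.prod σ τ)} (ht : Guard R t) : Guard R (Tm.snd t)
  | app {Γ σ τ} {R : Roles Γ} {t : Tm Γ (Ty.arr σ τ)} {u : Tm Γ σ} (ht : Guard R t)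
      (hu : Guard R u) : Guard R (Tm.app t u)
  | lam {Γ σ τ} {R : Roles Γ} {t : Tm (σ :: Γ) τ} (ht : Guard (R.ext Role.plain) t) :
      Guard R (Tm.lam t)
  | tt {Γ} {R : Roles Γ} : Guard R Tm.tt
  | ff {Γ} {R : Roles Γ} : Guard R Tm.ff
  | zero {Γ} {R : Roles Γ} : Guard R Tm.zero
  | nil {Γ} {τ : Ty} {R : Roles Γ} : Guard R (Tm.nil (τ := τ))
  | succ {Γ} {R : Roles Γ} {t : Tm Γ Ty.nat} (ht : Guard R t) : Guard R (Tm.succ t)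
  | cons {Γ τ} {R : Roles Γ} {t : Tm Γ τ} {u : Tm Γ (Ty.list τ)} (ht : Guard R t)
      (hu : Guard R u) : Guard R (Tm.cons t u)
  | caseNat {Γ τ} {R : Roles Γ} {t : Tm Γ Ty.nat} {u : Tm Γ τ} {v : Tm Γ (Ty.arr Ty.nat τ)}
      (ht : Guard R t) (hu : Guard R u) (hv : Guard R v) : Guard R (Tm.caseNat t u v)
  | caseBool {Γ τ} {R : Roles Γ} {t : Tm Γ Ty.bool} {u v : Tm Γ τ}
      (ht : Guard R t) (hu : Guard R u) (hv : Guard R v) : Guard R (Tm.caseBool t u v)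
  | caseList {Γ σ τ} {R : Roles Γ} {t : Tm Γ (Ty.list σ)} {u : Tm Γ τ}
      {v : Tm Γ (Ty.arr σ (Ty.arr (Ty.list σ) τ))}
      (ht : Guard R t) (hu : Guard R u) (hv : Guard R v) : Guard R (Tm.caseList t u v)
  | letrec {Γ I σ} {R : Roles Γ} {hI : Ind I} {e : Tm (I :: Ty.arr I σ :: Γ) σ}
      (he : Guard ((R.ext Role.plain).ext Role.plain) e) : Guard R (Tm.letrec hI e)

/-- The definition `letrec f x = e` is well-founded: all recursive calls in `e` are performed on
structurally smaller arguments. -/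
def WDef {Γ : Ctx} {I σ : Ty} (e : Tm (I :: Ty.arr I σ :: Γ) σ) : Prop :=
  Guard ((Roles.ext (fun _ _ => Role.plain) Role.fn).ext Role.arg) e

/-! ## Reduction and conversion -/

/-- Terms with a constructor in head position. -/
inductive IsCon : ∀ {Γ : Ctx} {τ : Ty}, Tm Γ τ → Prop
  | tt {Γ} : IsCon (Tm.tt (Γ := Γ))
  | ff {Γ} : IsCon (Tm.ff (Γ := Γ))
  | zero {Γ} : IsCon (Tm.zero (Γ := Γ))
  | succ {Γ} (t : Tm Γ Ty.nat) : IsCon (Tm.succ t)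
  | nil {Γ τ} : IsCon (Tm.nil (Γ := Γ) (τ := τ))
  | cons {Γ τ} (t : Tm Γ τ) (u : Tm Γ (Ty.list τ)) : IsCon (Tm.cons t u)

/-- `βιμ`-reduction: the contextual closure of the `β`-, `ι`- and `μ`-rules. -/
inductive Step : ∀ {Γ : Ctx} {τ : Ty}, Tm Γ τ → Tm Γ τ → Prop
  | beta {Γ σ τ} (t : Tm (σ :: Γ) τ) (u : Tm Γ σ) :
      Step (Tm.app (Tm.lam t) u) (t.subst (Sub.one u))
  | fstPair {Γ σ τ} (t : Tm Γ σ) (u : Tm Γ τ) : Step (Tm.fst (Tm.pair t u)) t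
  | sndPair {Γ σ τ} (t : Tm Γ σ) (u : Tm Γ τ) : Step (Tm.snd (Tm.pair t u)) u
  | caseNatZero {Γ τ} (u : Tm Γ τ) (v : Tm Γ (Ty.arr Ty.nat τ)) :
      Step (Tm.caseNat Tm.zero u v) u
  | caseNatSucc {Γ τ} (t : Tm Γ Ty.nat) (u : Tm Γ τ) (v : Tm Γ (Ty.arr Ty.nat τ)) :
      Step (Tm.caseNat (Tm.succ t) u v) (Tm.app v t)
  | caseBoolTt {Γ τ} (u v : Tm Γ τ) : Step (Tm.caseBool Tm.tt u v) u
  | caseBoolFf {Γ τ} (u v : Tm Γ τ) : Step (Tm.caseBool Tm.ff u v) v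
  | caseListNil {Γ σ τ} (u : Tm Γ τ) (v : Tm Γ (Ty.arr σ (Ty.arr (Ty.list σ) τ))) :
      Step (Tm.caseList Tm.nil u v) u
  | caseListCons {Γ σ τ} (h : Tm Γ σ) (t : Tm Γ (Ty.list σ)) (u : Tm Γ τ)
      (v : Tm Γ (Ty.arr σ (Ty.arr (Ty.list σ) τ))) :
      Step (Tm.caseList (Tm.cons h t) u v) (Tm.app (Tm.app v h) t)
  | mu {Γ I σ} (hI : Ind I) (e : Tm (I :: Ty.arr I σ :: Γ) σ) (t : Tm Γ I)
      (he : WDef e) (ht : IsCon t) :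
      Step (Tm.app (Tm.letrec hI e) t) (e.subst ((Sub.one (Tm.letrec hI e)).cons t))
  | pairL {Γ σ τ} {t t' : Tm Γ σ} {u : Tm Γ τ} (h : Step t t') :
      Step (Tm.pair t u) (Tm.pair t' u)
  | pairR {Γ σ τ} {t : Tm Γ σ} {u u' : Tm Γ τ} (h : Step u u') :
      Step (Tm.pair t u) (Tm.pair t u')
  | fst {Γ σ τ} {t t' : Tm Γ (Ty.prod σ τ)} (h : Step t t') : Step (Tm.fst t) (Tm.fst t')
  | snd {Γ σ τ} {t t' : Tm Γ (Ty.prod σ τ)} (h : Step t t') : Step (Tm.snd t) (Tm.snd t')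
  | appL {Γ σ τ} {t t' : Tm Γ (Ty.arr σ τ)} {u : Tm Γ σ} (h : Step t t') :
      Step (Tm.app t u) (Tm.app t' u)
  | appR {Γ σ τ} {t : Tm Γ (Ty.arr σ τ)} {u u' : Tm Γ σ} (h : Step u u') :
      Step (Tm.app t u) (Tm.app t u')
  | lam {Γ σ τ} {t t' : Tm (σ :: Γ) τ} (h : Step t t') : Step (Tm.lam t) (Tm.lam t')
  | succ {Γ} {t t' : Tm Γ Ty.nat} (h : Step t t') : Step (Tm.succ t) (Tm.succ t')
  | consL {Γ τ} {t t' : Tm Γ τ} {u : Tm Γ (Ty.list τ)} (h : Step t t') :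
      Step (Tm.cons t u) (Tm.cons t' u)
  | consR {Γ τ} {t : Tm Γ τ} {u u' : Tm Γ (Ty.list τ)} (h : Step u u') :
      Step (Tm.cons t u) (Tm.cons t u')
  | caseNat1 {Γ τ} {t t' : Tm Γ Ty.nat} {u : Tm Γ τ} {v : Tm Γ (Ty.arr Ty.nat τ)}
      (h : Step t t') : Step (Tm.caseNat t u v) (Tm.caseNat t' u v)
  | caseNat2 {Γ τ} {t : Tm Γ Ty.nat} {u u' : Tm Γ τ} {v : Tm Γ (Ty.arr Ty.nat τ)}
      (h : Step u u') : Step (Tm.caseNat t u v) (Tm.caseNat t u' v)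
  | caseNat3 {Γ τ} {t : Tm Γ Ty.nat} {u : Tm Γ τ} {v v' : Tm Γ (Ty.arr Ty.nat τ)}
      (h : Step v v') : Step (Tm.caseNat t u v) (Tm.caseNat t u v')
  | caseBool1 {Γ τ} {t t' : Tm Γ Ty.bool} {u v : Tm Γ τ} (h : Step t t') :
      Step (Tm.caseBool t u v) (Tm.caseBool t' u v)
  | caseBool2 {Γ τ} {t : Tm Γ Ty.bool} {u u' v : Tm Γ τ} (h : Step u u') :
      Step (Tm.caseBool t u v) (Tm.caseBool t u' v)
  | caseBool3 {Γ τ} {t : Tm Γ Ty.bool} {u v v' : Tm Γ τ} (h : Step v v') :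
      Step (Tm.caseBool t u v) (Tm.caseBool t u v')
  | caseList1 {Γ σ τ} {t t' : Tm Γ (Ty.list σ)} {u : Tm Γ τ}
      {v : Tm Γ (Ty.arr σ (Ty.arr (Ty.list σ) τ))} (h : Step t t') :
      Step (Tm.caseList t u v) (Tm.caseList t' u v)
  | caseList2 {Γ σ τ} {t : Tm Γ (Ty.list σ)} {u u' : Tm Γ τ}
      {v : Tm Γ (Ty.arr σ (Ty.arr (Ty.list σ) τ))} (h : Step u u') :
      Step (Tm.caseList t u v) (Tm.caseList t u' v)
  | caseList3 {Γ σ τ} {t : Tm Γ (Ty.list σ)} {u : Tm Γ τ}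
      {v v' : Tm Γ (Ty.arr σ (Ty.arr (Ty.list σ) τ))} (h : Step v v') :
      Step (Tm.caseList t u v) (Tm.caseList t u v')
  | letrec {Γ I σ} {hI : Ind I} {e e' : Tm (I :: Ty.arr I σ :: Γ) σ} (h : Step e e') :
      Step (Tm.letrec hI e) (Tm.letrec hI e')

/-- `βιμ`-convertibility. -/
def Conv {Γ : Ctx} {τ : Ty} (t u : Tm Γ τ) : Prop := Relation.EqvGen Step t u

/-! ## Derived terms -/

/-- Variables `0`, `1`, `2` of a context. -/
def v0 {Γ : Ctx} {τ : Ty} : Tm (τ :: Γ) τ := .var .z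
def v1 {Γ : Ctx} {τ τ₀ : Ty} : Tm (τ₀ :: τ :: Γ) τ := .var (.s .z)
def v2 {Γ : Ctx} {τ τ₀ τ₁ : Ty} : Tm (τ₀ :: τ₁ :: τ :: Γ) τ := .var (.s (.s .z))

/-- `let x = t in u`. -/
def letIn {Γ : Ctx} {σ τ : Ty} (t : Tm Γ σ) (u : Tm (σ :: Γ) τ) : Tm Γ τ := .app (.lam u) t

/-- Numerals. -/
def num {Γ : Ctx} : ℕ → Tm Γ Ty.nat
  | 0 => .zero
  | n + 1 => .succ (num n)

/-- `λ m. letrec f n = case n of 0 ↦ m | S n' ↦ S (f n')`. -/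
def addFn {Γ : Ctx} : Tm Γ (Ty.arr Ty.nat (Ty.arr Ty.nat Ty.nat)) :=
  .lam (.letrec Ind.nat
    (.caseNat (.var .z) (.var (.s (.s .z)))
      (.lam (.succ (.app (.var (.s (.s .z))) (.var .z))))))

/-- Addition of natural numbers in PCF. -/
def add {Γ : Ctx} (t u : Tm Γ Ty.nat) : Tm Γ Ty.nat := .app (.app addFn t) u

/-- `letrec f l = case l of [] ↦ 0 | h :: t ↦ S (f t)`. -/
def lenFn {Γ : Ctx} {τ : Ty} : Tm Γ (Ty.arr (Ty.list τ) Ty.nat) :=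
  .letrec (Ind.list τ)
    (.caseList (.var .z) .zero
      (.lam (.lam (.succ (.app (.var (.s (.s (.s .z)))) (.var .z))))))

/-- The size `|t|` of an element of an inductive type: a number itself, the length of a list. -/
def size {Γ : Ctx} {I : Ty} (hI : Ind I) (t : Tm Γ I) : Tm Γ Ty.nat :=
  match hI, t with
  | .nat, t => t
  | .list _, t => .app lenFn t

/-! ## Higher-order logic -/

/-- Assertions.  The basic predicates are equality at each type and `listU(n, l, λ x. φ)`. -/
inductive Fm : Ctx → Type
  | eq {Γ τ} (t u : Tm Γ τ) : Fm Γ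
  | listU {Γ τ} (n : Tm Γ Ty.nat) (l : Tm Γ (Ty.list τ)) (φ : Fm (τ :: Γ)) : Fm Γ
  | top {Γ} : Fm Γ
  | bot {Γ} : Fm Γ
  | and {Γ} (φ ψ : Fm Γ) : Fm Γ
  | or {Γ} (φ ψ : Fm Γ) : Fm Γ
  | imp {Γ} (φ ψ : Fm Γ) : Fm Γ
  | all {Γ} (τ : Ty) (φ : Fm (τ :: Γ)) : Fm Γ
  | ex {Γ} (τ : Ty) (φ : Fm (τ :: Γ)) : Fm Γ

def Fm.subst : ∀ {Γ : Ctx}, Fm Γ → ∀ {Δ : Ctx}, Sub Γ Δ → Fm Δ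
  | _, .eq t u, _, s => .eq (t.subst s) (u.subst s)
  | _, .listU n l φ, _, s => .listU (n.subst s) (l.subst s) (φ.subst s.lift)
  | _, .top, _, _ => .top
  | _, .bot, _, _ => .bot
  | _, .and φ ψ, _, s => .and (φ.subst s) (ψ.subst s)
  | _, .or φ ψ, _, s => .or (φ.subst s) (ψ.subst s)
  | _, .imp φ ψ, _, s => .imp (φ.subst s) (ψ.subst s)
  | _, .all τ φ, _, s => .all τ (φ.subst s.lift)
  | _, .ex τ φ, _, s => .ex τ (φ.subst s.lift)

def Fm.rename {Γ Δ : Ctx} (φ : Fm Γ) (r : Ren Γ Δ) : Fm Δ := φ.subst (Sub.ofRen r)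

def Fm.wk {Γ : Ctx} {σ : Ty} (φ : Fm Γ) : Fm (σ :: Γ) := φ.rename (fun _ x => .s x)

/-- `φ[t/x]`, for `x` the most recent variable. -/
def Fm.inst {Γ : Ctx} {σ : Ty} (φ : Fm (σ :: Γ)) (t : Tm Γ σ) : Fm Γ := φ.subst (Sub.one t)

def Fm.iff {Γ : Ctx} (φ ψ : Fm Γ) : Fm Γ := .and (.imp φ ψ) (.imp ψ φ)

def Fm.neg {Γ : Ctx} (φ : Fm Γ) : Fm Γ := .imp φ .bot

/-- `t ≤ u`, that is `∃ d. t + d = u`. -/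
def Fm.le {Γ : Ctx} (t u : Tm Γ Ty.nat) : Fm Γ := .ex Ty.nat (.eq (add t.wk v0) u.wk)

def Fm.lt {Γ : Ctx} (t u : Tm Γ Ty.nat) : Fm Γ := .le (.succ t) u

/-- Weakening of a set of assertions by one variable. -/
def wkAll {Γ : Ctx} {σ : Ty} (Ψ : List (Fm Γ)) : List (Fm (σ :: Γ)) := Ψ.map Fm.wk

/-- For a context `Γ`, the embedding of its variables below one, two or three new variables. -/
def up1 {Γ : Ctx} {σ : Ty} : Ren Γ (σ :: Γ) := fun _ x => .s x
def up2 {Γ : Ctx} {σ σ' : Ty} : Ren Γ (σ :: σ' :: Γ) := fun _ x => .s (.s x)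
def up3 {Γ : Ctx} {σ σ' σ'' : Ty} : Ren Γ (σ :: σ' :: σ'' :: Γ) := fun _ x => .s (.s (.s x))

/-- Derivability `Γ ∣ Ψ ⊢ φ` in higher-order logic: natural deduction over PCF terms with
conversion, substitution of equals, induction, non-overlap and injectivity of constructors,
and the defining axioms of `listU`. -/
inductive HOL : ∀ {Γ : Ctx}, List (Fm Γ) → Fm Γ → Prop
  | ax {Γ} {Ψ : List (Fm Γ)} {φ : Fm Γ} (h : φ ∈ Ψ) : HOL Ψ φ
  | conv {Γ τ} {Ψ : List (Fm Γ)} {t u : Tm Γ τ} (h : Conv t u) : HOL Ψ (.eq t u)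
  | subst {Γ τ} {Ψ : List (Fm Γ)} (φ : Fm (τ :: Γ)) {t u : Tm Γ τ}
      (h : HOL Ψ (φ.inst t)) (he : HOL Ψ (.eq t u)) : HOL Ψ (φ.inst u)
  | topI {Γ} {Ψ : List (Fm Γ)} : HOL Ψ .top
  | botE {Γ} {Ψ : List (Fm Γ)} (φ : Fm Γ) (h : HOL Ψ .bot) : HOL Ψ φ
  | impI {Γ} {Ψ : List (Fm Γ)} {φ ψ : Fm Γ} (h : HOL (φ :: Ψ) ψ) : HOL Ψ (.imp φ ψ)
  | impE {Γ} {Ψ : List (Fm Γ)} {φ ψ : Fm Γ} (h : HOL Ψ (.imp φ ψ)) (h' : HOL Ψ φ) : HOL Ψ ψ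
  | andI {Γ} {Ψ : List (Fm Γ)} {φ ψ : Fm Γ} (h : HOL Ψ φ) (h' : HOL Ψ ψ) : HOL Ψ (.and φ ψ)
  | andE1 {Γ} {Ψ : List (Fm Γ)} {φ ψ : Fm Γ} (h : HOL Ψ (.and φ ψ)) : HOL Ψ φ
  | andE2 {Γ} {Ψ : List (Fm Γ)} {φ ψ : Fm Γ} (h : HOL Ψ (.and φ ψ)) : HOL Ψ ψ
  | orI1 {Γ} {Ψ : List (Fm Γ)} {φ ψ : Fm Γ} (h : HOL Ψ φ) : HOL Ψ (.or φ ψ)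
  | orI2 {Γ} {Ψ : List (Fm Γ)} {φ ψ : Fm Γ} (h : HOL Ψ ψ) : HOL Ψ (.or φ ψ)
  | orE {Γ} {Ψ : List (Fm Γ)} {φ ψ χ : Fm Γ} (h : HOL Ψ (.or φ ψ)) (h₁ : HOL (φ :: Ψ) χ)
      (h₂ : HOL (ψ :: Ψ) χ) : HOL Ψ χ
  | allI {Γ τ} {Ψ : List (Fm Γ)} {φ : Fm (τ :: Γ)} (h : HOL (wkAll Ψ) φ) : HOL Ψ (.all τ φ)
  | allE {Γ τ} {Ψ : List (Fm Γ)} {φ : Fm (τ :: Γ)} (h : HOL Ψ (.all τ φ)) (t : Tm Γ τ) :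
      HOL Ψ (φ.inst t)
  | exI {Γ τ} {Ψ : List (Fm Γ)} {φ : Fm (τ :: Γ)} (t : Tm Γ τ) (h : HOL Ψ (φ.inst t)) :
      HOL Ψ (.ex τ φ)
  | exE {Γ τ} {Ψ : List (Fm Γ)} {φ : Fm (τ :: Γ)} {χ : Fm Γ} (h : HOL Ψ (.ex τ φ))
      (h' : HOL (φ :: wkAll Ψ) χ.wk) : HOL Ψ χ
  | boolInd {Γ} {Ψ : List (Fm Γ)} {φ : Fm (Ty.bool :: Γ)} (ht : HOL Ψ (φ.inst .tt))
      (hf : HOL Ψ (φ.inst .ff)) : HOL Ψ (.all Ty.bool φ)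
  | natInd {Γ} {Ψ : List (Fm Γ)} {φ : Fm (Ty.nat :: Γ)} (hz : HOL Ψ (φ.inst .zero))
      (hs : HOL (φ :: wkAll Ψ) (φ.subst ((Sub.ofRen up1).cons (.succ v0)))) :
      HOL Ψ (.all Ty.nat φ)
  | listInd {Γ τ} {Ψ : List (Fm Γ)} {φ : Fm (Ty.list τ :: Γ)} (hn : HOL Ψ (φ.inst .nil))
      (hc : HOL (φ.subst ((Sub.ofRen up2).cons v0) :: wkAll (wkAll Ψ))
        (φ.subst ((Sub.ofRen (up2 (σ := Ty.list τ) (σ' := τ))).cons (.cons v1 v0)))) :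
      HOL Ψ (.all (Ty.list τ) φ)
  | strongInd {Γ I} {Ψ : List (Fm Γ)} (hI : Ind I) {φ : Fm (I :: Γ)}
      (h : HOL (.all I (.imp (.lt (size hI v0) (size hI v1))
        (φ.subst ((Sub.ofRen up2).cons v0))) :: wkAll Ψ) φ) : HOL Ψ (.all I φ)
  | ncBool {Γ} {Ψ : List (Fm Γ)} : HOL Ψ (Fm.neg (.eq .tt .ff))
  | ncNat {Γ} {Ψ : List (Fm Γ)} (t : Tm Γ Ty.nat) : HOL Ψ (Fm.neg (.eq .zero (.succ t)))
  | ncList {Γ τ} {Ψ : List (Fm Γ)} (h : Tm Γ τ) (t : Tm Γ (Ty.list τ)) :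
      HOL Ψ (Fm.neg (.eq .nil (.cons h t)))
  | succInj {Γ} {Ψ : List (Fm Γ)} {t u : Tm Γ Ty.nat} (h : HOL Ψ (.eq (.succ t) (.succ u))) :
      HOL Ψ (.eq t u)
  | consInj1 {Γ τ} {Ψ : List (Fm Γ)} {t t' : Tm Γ τ} {u u' : Tm Γ (Ty.list τ)}
      (h : HOL Ψ (.eq (.cons t u) (.cons t' u'))) : HOL Ψ (.eq t t')
  | consInj2 {Γ τ} {Ψ : List (Fm Γ)} {t t' : Tm Γ τ} {u u' : Tm Γ (Ty.list τ)}
      (h : HOL Ψ (.eq (.cons t u) (.cons t' u'))) : HOL Ψ (.eq u u')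
  | listUZero {Γ τ} {Ψ : List (Fm Γ)} (l : Tm Γ (Ty.list τ)) (φ : Fm (τ :: Γ)) :
      HOL Ψ (Fm.iff (.listU .zero l φ) (.eq l .nil))
  | listUSucc {Γ τ} {Ψ : List (Fm Γ)} (n : Tm Γ Ty.nat) (l : Tm Γ (Ty.list τ))
      (φ : Fm (τ :: Γ)) :
      HOL Ψ (Fm.iff (.listU (.succ n) l φ)
        (.ex τ (.ex (Ty.list τ)
          (.and (.eq l.wk.wk (.cons v1 v0))
            (.and (φ.subst ((Sub.ofRen up2).cons v1))
              (.listU n.wk.wk v0 (φ.rename (up2 (σ := Ty.list τ) (σ' := τ)).lift)))))))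

/-! ## Unary higher-order logic -/

/-- The assertion `∀ x. φ' ⇒ φ[r x / r]` about a function `r`, where `φ'` depends on `x` and
`φ` on `x` and on the result `r` (its most recent variable). -/
def funSpec {Γ : Ctx} {τ σ : Ty} (φ' : Fm (τ :: Γ)) (φ : Fm (σ :: τ :: Γ)) :
    Fm (Ty.arr τ σ :: Γ) :=
  .all τ (.imp (φ'.subst ((Sub.ofRen up2).cons v0))
    (φ.subst (((Sub.ofRen up2).cons v0).cons (.app v1 v0))))

/-- The induction hypothesis `∀ m. |m| < |x| ⇒ φ'[m/x] ⇒ φ[m/x][f m / r]`, in the context with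
`x` and `f`. -/
def recHyp {Γ : Ctx} {I σ : Ty} (hI : Ind I) (φ' : Fm (I :: Γ)) (φ : Fm (σ :: I :: Γ)) :
    Fm (I :: Ty.arr I σ :: Γ) :=
  .all I (.imp (.lt (size hI v0) (size hI v1))
    (.imp (φ'.subst ((Sub.ofRen up3).cons v0))
      (φ.subst (((Sub.ofRen up3).cons v0).cons (.app v2 v0)))))

/-- Derivability `Γ ∣ Ψ ⊢ t : σ ∣ φ` in unary higher-order logic; the distinguished variable `r`
is the most recent variable of `φ`. -/
inductive UHOL : ∀ {Γ : Ctx} {σ : Ty}, List (Fm Γ) → Tm Γ σ → Fm (σ :: Γ) → Prop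
  | var {Γ σ} {Ψ : List (Fm Γ)} {x : Var Γ σ} {φ : Fm (σ :: Γ)} (h : HOL Ψ (φ.inst (.var x))) :
      UHOL Ψ (.var x) φ
  | abs {Γ τ σ} {Ψ : List (Fm Γ)} {t : Tm (τ :: Γ) σ} {φ' : Fm (τ :: Γ)} {φ : Fm (σ :: τ :: Γ)}
      (h : UHOL (φ' :: wkAll Ψ) t φ) : UHOL Ψ (.lam t) (funSpec φ' φ)
  | app {Γ τ σ} {Ψ : List (Fm Γ)} {t : Tm Γ (Ty.arr τ σ)} {u : Tm Γ τ} {φ' : Fm (τ :: Γ)}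
      {φ : Fm (σ :: τ :: Γ)} (ht : UHOL Ψ t (funSpec φ' φ)) (hu : UHOL Ψ u φ') :
      UHOL Ψ (.app t u) (φ.subst (Sub.one u).lift)
  | tt {Γ} {Ψ : List (Fm Γ)} {φ : Fm (Ty.bool :: Γ)} (h : HOL Ψ (φ.inst .tt)) : UHOL Ψ .tt φ
  | ff {Γ} {Ψ : List (Fm Γ)} {φ : Fm (Ty.bool :: Γ)} (h : HOL Ψ (φ.inst .ff)) : UHOL Ψ .ff φ
  | zero {Γ} {Ψ : List (Fm Γ)} {φ : Fm (Ty.nat :: Γ)} (h : HOL Ψ (φ.inst .zero)) :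
      UHOL Ψ .zero φ
  | nil {Γ τ} {Ψ : List (Fm Γ)} {φ : Fm (Ty.list τ :: Γ)} (h : HOL Ψ (φ.inst .nil)) :
      UHOL Ψ .nil φ
  | succ {Γ} {Ψ : List (Fm Γ)} {t : Tm Γ Ty.nat} {φ' φ : Fm (Ty.nat :: Γ)} (ht : UHOL Ψ t φ')
      (h : HOL Ψ (.all Ty.nat (.imp φ' (φ.subst ((Sub.ofRen up1).cons (.succ v0)))))) :
      UHOL Ψ (.succ t) φ
  | cons {Γ τ} {Ψ : List (Fm Γ)} {t : Tm Γ τ} {u : Tm Γ (Ty.list τ)} {φ' : Fm (τ :: Γ)}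
      {φ'' φ : Fm (Ty.list τ :: Γ)} (ht : UHOL Ψ t φ') (hu : UHOL Ψ u φ'')
      (h : HOL Ψ (.all τ (.all (Ty.list τ)
        (.imp (φ'.subst ((Sub.ofRen up2).cons v1))
          (.imp (φ''.subst ((Sub.ofRen up2).cons v0))
            (φ.subst ((Sub.ofRen up2).cons (.cons v1 v0)))))))) :
      UHOL Ψ (.cons t u) φ
  | pair {Γ σ τ} {Ψ : List (Fm Γ)} {t : Tm Γ σ} {u : Tm Γ τ} {φ' : Fm (σ :: Γ)}
      {φ'' : Fm (τ :: Γ)} {φ : Fm (Ty.prod σ τ :: Γ)} (ht : UHOL Ψ t φ') (hu : UHOL Ψ u φ'')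
      (h : HOL Ψ (.all σ (.all τ
        (.imp (φ'.subst ((Sub.ofRen up2).cons v1))
          (.imp (φ''.subst ((Sub.ofRen up2).cons v0))
            (φ.subst ((Sub.ofRen up2).cons (.pair v1 v0)))))))) :
      UHOL Ψ (.pair t u) φ
  | proj1 {Γ σ τ} {Ψ : List (Fm Γ)} {t : Tm Γ (Ty.prod σ τ)} {φ : Fm (σ :: Γ)}
      (ht : UHOL Ψ t (φ.subst ((Sub.ofRen up1).cons (.fst v0)))) : UHOL Ψ (.fst t) φ
  | proj2 {Γ σ τ} {Ψ : List (Fm Γ)} {t : Tm Γ (Ty.prod σ τ)} {φ : Fm (τ :: Γ)}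
      (ht : UHOL Ψ t (φ.subst ((Sub.ofRen up1).cons (.snd v0)))) : UHOL Ψ (.snd t) φ
  | sub {Γ σ} {Ψ : List (Fm Γ)} {t : Tm Γ σ} {φ' φ : Fm (σ :: Γ)} (ht : UHOL Ψ t φ')
      (h : HOL Ψ (.imp (φ'.inst t) (φ.inst t))) : UHOL Ψ t φ
  | boolCase {Γ σ} {Ψ : List (Fm Γ)} {t : Tm Γ Ty.bool} {u v : Tm Γ σ} {φ : Fm (σ :: Γ)}
      (hu : UHOL (.eq t .tt :: Ψ) u φ) (hv : UHOL (.eq t .ff :: Ψ) v φ) :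
      UHOL Ψ (.caseBool t u v) φ
  | natCase {Γ σ} {Ψ : List (Fm Γ)} {t : Tm Γ Ty.nat} {u : Tm Γ σ}
      {v : Tm Γ (Ty.arr Ty.nat σ)} {φ : Fm (σ :: Γ)} (hu : UHOL (.eq t .zero :: Ψ) u φ)
      (hv : UHOL Ψ v (.all Ty.nat (.imp (.eq t.wk.wk (.succ v0))
        (φ.subst ((Sub.ofRen up2).cons (.app v1 v0)))))) :
      UHOL Ψ (.caseNat t u v) φ
  | listCase {Γ τ σ} {Ψ : List (Fm Γ)} {t : Tm Γ (Ty.list τ)} {u : Tm Γ σ}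
      {v : Tm Γ (Ty.arr τ (Ty.arr (Ty.list τ) σ))} {φ : Fm (σ :: Γ)}
      (hu : UHOL (.eq t .nil :: Ψ) u φ)
      (hv : UHOL Ψ v (.all τ (.all (Ty.list τ) (.imp (.eq t.wk.wk.wk (.cons v1 v0))
        (φ.subst ((Sub.ofRen up3).cons (.app (.app v2 v1) v0))))))) :
      UHOL Ψ (.caseList t u v) φ
  | letrec {Γ I σ} {Ψ : List (Fm Γ)} (hI : Ind I) {e : Tm (I :: Ty.arr I σ :: Γ) σ}
      {φ' : Fm (I :: Γ)} {φ : Fm (σ :: I :: Γ)} (hw : WDef e)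
      (he : UHOL (recHyp hI φ' φ :: φ'.subst ((Sub.ofRen up2).cons v0) :: wkAll (wkAll Ψ)) e
        (φ.rename (Ren.lift (Ren.lift up1)))) :
      UHOL Ψ (.letrec hI e) (funSpec φ' φ)

/-! ## RelCost: simply-typed expressions and their cost-instrumented translation -/

/-- The simple types that are erasures of unary RelCost types. -/
inductive STy : Type
  | nat
  | list (σ : STy)
  | arr (σ τ : STy)

/-- Value translation of simple types; the expression translation of `σ` is `σ.cv × ℕ`. -/
def STy.cv : STy → Ty
  | .nat => .nat
  | .list σ => .list σ.cv
  | .arr σ τ => .arr σ.cv (.prod τ.cv .nat)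

/-- Expression translation of simple types. -/
abbrev STy.ce (σ : STy) : Ty := .prod σ.cv .nat

/-- RelCost expressions (without recursion), typed by simple types: variables, numerals, `λ`,
application, index abstraction `Λ. t`, index application `t []`, lists and case analysis on
lists.  In `caseL t t₁ t₂` the branch `t₂` has variable `1` for the head and `0` for the tail. -/
inductive Exp : List STy → STy → Type
  | var {G σ} (x : Var G σ) : Exp G σ
  | const {G} (n : ℕ) : Exp G STy.nat
  | lam {G σ τ} (t : Exp (σ :: G) τ) : Exp G (STy.arr σ τ)
  | app {G σ τ} (t : Exp G (STy.arr σ τ)) (u : Exp G σ) : Exp G τ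
  | ilam {G σ} (t : Exp G σ) : Exp G (STy.arr STy.nat σ)
  | iapp {G σ} (t : Exp G (STy.arr STy.nat σ)) : Exp G σ
  | nil {G σ} : Exp G (STy.list σ)
  | cons {G σ} (t : Exp G σ) (u : Exp G (STy.list σ)) : Exp G (STy.list σ)
  | caseL {G σ τ} (t : Exp G (STy.list σ)) (t₁ : Exp G τ)
      (t₂ : Exp (STy.list σ :: σ :: G) τ) : Exp G τ

/-- The costs of an application, an index application and a case analysis. -/
structure Costs where
  cApp : ℕ
  cIApp : ℕ
  cCase : ℕ

/-- Assignments of PCF variables (of translated type) to the program variables. -/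
abbrev VMap (G : List STy) (Γ : Ctx) := ∀ ⦃σ : STy⦄, Var G σ → Var Γ σ.cv

def VMap.lift {G : List STy} {Γ : Ctx} {σ : STy} (r : VMap G Γ) : VMap (σ :: G) (σ.cv :: Γ)
  | _, .z => .z
  | _, .s x => .s (r x)

/-- Pass under one PCF binder. -/
def VMap.wk {G : List STy} {Γ : Ctx} {τ : Ty} (r : VMap G Γ) : VMap G (τ :: Γ) :=
  fun _ x => .s (r x)

/-- The cost-instrumented translation of expressions, in any PCF context `Γ` that has the program
variables among its variables, at the positions given by the second argument. -/
def Exp.cost (c : Costs) : ∀ {G : List STy} {σ : STy}, Exp G σ →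
    ∀ {Γ : Ctx}, VMap G Γ → Tm Γ σ.ce
  | _, _, .var x, _, r => .pair (.var (r x)) .zero
  | _, _, .const n, _, _ => .pair (num n) .zero
  | _, _, .lam t, _, r => .pair (.lam (t.cost c r.lift)) .zero
  | _, _, .ilam t, _, r => .pair (.lam (t.cost c r.wk)) .zero
  | _, _, .app t u, _, r =>
      letIn (t.cost c r)
        (letIn (u.cost c r.wk)
          (letIn (.app (.fst v1) (.fst v0))
            (.pair (.fst v0)
              (add (add (add (.snd v2) (.snd v1)) (.snd v0)) (num c.cApp)))))
  | _, _, .iapp t, _, r =>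
      letIn (t.cost c r)
        (letIn (.app (.fst v0) .zero)
          (.pair (.fst v0) (add (add (.snd v1) (.snd v0)) (num c.cIApp))))
  | _, _, .nil, _, _ => .pair .nil .zero
  | _, _, .cons t u, _, r =>
      letIn (t.cost c r)
        (letIn (u.cost c r.wk)
          (.pair (.cons (.fst v1) (.fst v0)) (add (.snd v1) (.snd v0))))
  | _, _, .caseL t t₁ t₂, _, r =>
      letIn (t.cost c r)
        (.caseList (.fst v0)
          (letIn (t₁.cost c r.wk)
            (.pair (.fst v0) (add (add (.snd v1) (.snd v0)) (num c.cCase))))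
          (.lam (.lam
            (letIn (t₂.cost c r.wk.lift.lift)
              (.pair (.fst v0)
                (add (add (.snd (.var (.s (.s (.s .z))))) (.snd v0)) (num c.cCase)))))))

/-! ## RelCost: unary types and their predicates -/

/-- Index terms over the index variables `Δ`: PCF terms of type `ℕ`. -/
abbrev Idx (Δ : Ctx) := Tm Δ Ty.nat

/-- Upper cost bounds: an index term or infinity. -/
inductive UB (Δ : Ctx) : Type
  | fin (I : Idx Δ) : UB Δ
  | inf : UB Δ

def UB.subst {Δ Δ' : Ctx} (l : UB Δ) (s : Sub Δ Δ') : UB Δ' :=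
  match l with
  | .fin I => .fin (I.subst s)
  | .inf => .inf

def UB.add {Δ : Ctx} (l l' : UB Δ) : UB Δ :=
  match l, l' with
  | .fin I, .fin J => .fin (RelCost.add I J)
  | _, _ => .inf

/-- The assertion `t ≤ l`. -/
def Fm.leUB {Γ : Ctx} (t : Tm Γ Ty.nat) (l : UB Γ) : Fm Γ :=
  match l with
  | .fin I => .le t I
  | .inf => .top

/-- The constraint `l ≤ l'` between upper bounds. -/
def UB.le {Δ : Ctx} (l l' : UB Δ) : Fm Δ :=
  match l, l' with
  | _, .inf => .top
  | .fin I, .fin J => Fm.le I J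
  | .inf, .fin _ => .bot

/-- `UTy Δ σ` is the type of unary types `A` over the index variables `Δ` with erasure `|A| = σ`:
`ℕ`, `list A [I]`, `A → B` with effect `exec(k, l)`, and `∀ i. A` with effect `exec(k, l)`, where
`i` is bound in `k`, `l` and `A`. -/
inductive UTy : Ctx → STy → Type
  | nat {Δ} : UTy Δ STy.nat
  | list {Δ σ} (A : UTy Δ σ) (I : Idx Δ) : UTy Δ (STy.list σ)
  | arr {Δ σ τ} (A : UTy Δ σ) (k : Idx Δ) (l : UB Δ) (B : UTy Δ τ) : UTy Δ (STy.arr σ τ)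
  | all {Δ σ} (k : Idx (Ty.nat :: Δ)) (l : UB (Ty.nat :: Δ)) (A : UTy (Ty.nat :: Δ) σ) :
      UTy Δ (STy.arr STy.nat σ)

/-- Substitution of index terms in unary types. -/
def UTy.subst : ∀ {Δ : Ctx} {σ : STy}, UTy Δ σ → ∀ {Δ' : Ctx}, Sub Δ Δ' → UTy Δ' σ
  | _, _, .nat, _, _ => .nat
  | _, _, .list A I, _, s => .list (A.subst s) (I.subst s)
  | _, _, .arr A k l B, _, s => .arr (A.subst s) (k.subst s) (l.subst s) (B.subst s)
  | _, _, .all k l A, _, s => .all (k.subst s.lift) (l.subst s.lift) (A.subst s.lift)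

def UB.wk {Δ : Ctx} {τ : Ty} (l : UB Δ) : UB (τ :: Δ) := l.subst (Sub.ofRen up1)

def UTy.wk {Δ : Ctx} {σ : STy} {τ : Ty} (A : UTy Δ σ) : UTy (τ :: Δ) σ :=
  A.subst (Sub.ofRen up1)

/-- Given the predicate `P` of the value part, the assertion `P (π₁ x) ∧ k ≤ π₂ x ≤ l`. -/
def expSpec {Γ : Ctx} {τ : Ty} (P : Tm Γ τ → Fm Γ) (k : Tm Γ Ty.nat) (l : UB Γ)
    (x : Tm Γ (Ty.prod τ Ty.nat)) : Fm Γ :=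
  .and (P (.fst x)) (.and (.le k (.snd x)) (Fm.leUB (.snd x) l))

/-- The value predicate `⌊A⌋ᵥ(x)`, in a context `Γ` in which the index variables of `A` stand for
the terms given by `s`. -/
def UTy.val : ∀ {Δ : Ctx} {σ : STy}, UTy Δ σ → ∀ {Γ : Ctx}, Sub Δ Γ → Tm Γ σ.cv → Fm Γ
  | _, _, .nat, _, _, _ => .top
  | _, _, .list A I, _, s, x => .listU (I.subst s) x (A.val s.wk v0)
  | _, _, .arr (σ := σ) A k l B, _, s, x =>
      .all σ.cv (.imp (A.val s.wk v0)
        (expSpec (fun y => B.val s.wk y) (k.subst s.wk) (l.subst s.wk) (.app x.wk v0)))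
  | _, _, .all k l A, _, s, x =>
      .all Ty.nat (.imp .top
        (.all Ty.nat
          (expSpec (fun y => A.val (s.wk.wk.cons v0) y) (k.subst (s.wk.wk.cons v0))
            (l.subst (s.wk.wk.cons v0)) (.app x.wk.wk v1))))

/-- The expression predicate `⌊A⌋ₑ^{k,l}(x)`. -/
def UTy.exp {Δ : Ctx} {σ : STy} (A : UTy Δ σ) (k : Idx Δ) (l : UB Δ) {Γ : Ctx} (s : Sub Δ Γ)
    (x : Tm Γ σ.ce) : Fm Γ :=
  expSpec (fun y => A.val s y) (k.subst s) (l.subst s) x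

/-- Unary type environments, with the erasures of their types. -/
inductive UEnv (Δ : Ctx) : List STy → Type
  | nil : UEnv Δ []
  | cons {G : List STy} {σ : STy} (A : UTy Δ σ) (Ω : UEnv Δ G) : UEnv Δ (σ :: G)

def UEnv.lookup {Δ : Ctx} : ∀ {G : List STy} {σ : STy}, UEnv Δ G → Var G σ → UTy Δ σ
  | _, _, .cons A _, .z => A
  | _, _, .cons _ Ω, .s x => Ω.lookup x

def UEnv.wk {Δ : Ctx} {τ : Ty} : ∀ {G : List STy}, UEnv Δ G → UEnv (τ :: Δ) G
  | _, .nil => .nil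
  | _, .cons A Ω => .cons A.wk Ω.wk

/-- The assertions `⌊Ω⌋`: one for each program variable. -/
def UEnv.fms {Δ : Ctx} : ∀ {G : List STy}, UEnv Δ G → ∀ {Γ : Ctx}, Sub Δ Γ → VMap G Γ →
    List (Fm Γ)
  | _, .nil, _, _, _ => []
  | _, .cons A Ω, _, s, r => A.val s (.var (r .z)) :: Ω.fms s (fun _ x => r (.s x))

/-! ## RelCost: subtyping and unary typing -/

/-- Unary subtyping `Δ; Φ ⊢ A ⊑ A'`.  Constraints on index terms are assertions over `Δ`, and
entailment between them is derivability in higher-order logic. -/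
inductive USub : ∀ {Δ : Ctx} {σ : STy}, List (Fm Δ) → UTy Δ σ → UTy Δ σ → Prop
  | refl {Δ σ} {Φ : List (Fm Δ)} (A : UTy Δ σ) : USub Φ A A
  | trans {Δ σ} {Φ : List (Fm Δ)} {A B C : UTy Δ σ} (h : USub Φ A B) (h' : USub Φ B C) :
      USub Φ A C
  | list {Δ σ} {Φ : List (Fm Δ)} {A A' : UTy Δ σ} {I I' : Idx Δ} (h : USub Φ A A')
      (hI : HOL Φ (.eq I I')) : USub Φ (.list A I) (.list A' I')
  | arr {Δ σ τ} {Φ : List (Fm Δ)} {A A' : UTy Δ σ} {B B' : UTy Δ τ} {k k' : Idx Δ}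
      {l l' : UB Δ} (hA : USub Φ A' A) (hB : USub Φ B B') (hk : HOL Φ (.le k' k))
      (hl : HOL Φ (l.le l')) : USub Φ (.arr A k l B) (.arr A' k' l' B')
  | all {Δ σ} {Φ : List (Fm Δ)} {A A' : UTy (Ty.nat :: Δ) σ} {k k' : Idx (Ty.nat :: Δ)}
      {l l' : UB (Ty.nat :: Δ)} (hA : USub (wkAll Φ) A A') (hk : HOL (wkAll Φ) (.le k' k))
      (hl : HOL (wkAll Φ) (l.le l')) : USub Φ (.all k l A) (.all k' l' A')

/-- The unary judgment `Δ; Φ; Ω ⊢ t : A` with minimal cost `k` and maximal cost `l`. -/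
inductive UTyping (c : Costs) : ∀ {Δ : Ctx} {G : List STy} {σ : STy}, List (Fm Δ) → UEnv Δ G →
    Idx Δ → UB Δ → Exp G σ → UTy Δ σ → Prop
  | var {Δ G σ} {Φ : List (Fm Δ)} {Ω : UEnv Δ G} (x : Var G σ) :
      UTyping c Φ Ω .zero (.fin .zero) (.var x) (Ω.lookup x)
  | const {Δ G} {Φ : List (Fm Δ)} {Ω : UEnv Δ G} (n : ℕ) :
      UTyping c Φ Ω .zero (.fin .zero) (.const n) .nat
  | lam {Δ G σ τ} {Φ : List (Fm Δ)} {Ω : UEnv Δ G} {A : UTy Δ σ} {B : UTy Δ τ} {k : Idx Δ}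
      {l : UB Δ} {t : Exp (σ :: G) τ} (h : UTyping c Φ (.cons A Ω) k l t B) :
      UTyping c Φ Ω .zero (.fin .zero) (.lam t) (.arr A k l B)
  | app {Δ G σ τ} {Φ : List (Fm Δ)} {Ω : UEnv Δ G} {A : UTy Δ σ} {B : UTy Δ τ}
      {k k₁ k₂ : Idx Δ} {l l₁ l₂ : UB Δ} {t₁ : Exp G (.arr σ τ)} {t₂ : Exp G σ}
      (h₁ : UTyping c Φ Ω k₁ l₁ t₁ (.arr A k l B)) (h₂ : UTyping c Φ Ω k₂ l₂ t₂ A) :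
      UTyping c Φ Ω (add (add (add k₁ k₂) k) (num c.cApp))
        (((l₁.add l₂).add l).add (.fin (num c.cApp))) (.app t₁ t₂) B
  | ilam {Δ G σ} {Φ : List (Fm Δ)} {Ω : UEnv Δ G} {A : UTy (Ty.nat :: Δ) σ}
      {k : Idx (Ty.nat :: Δ)} {l : UB (Ty.nat :: Δ)} {t : Exp G σ}
      (h : UTyping c (wkAll Φ) Ω.wk k l t A) :
      UTyping c Φ Ω .zero (.fin .zero) (.ilam t) (.all k l A)
  | iapp {Δ G σ} {Φ : List (Fm Δ)} {Ω : UEnv Δ G} {A : UTy (Ty.nat :: Δ) σ} {k : Idx Δ}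
      {l : UB Δ} {k' : Idx (Ty.nat :: Δ)} {l' : UB (Ty.nat :: Δ)}
      {t : Exp G (.arr .nat σ)} (h : UTyping c Φ Ω k l t (.all k' l' A)) (J : Idx Δ) :
      UTyping c Φ Ω (add (add k (k'.subst (Sub.one J))) (num c.cIApp))
        ((l.add (l'.subst (Sub.one J))).add (.fin (num c.cIApp))) (.iapp t)
        (A.subst (Sub.one J))
  | nil {Δ G σ} {Φ : List (Fm Δ)} {Ω : UEnv Δ G} (A : UTy Δ σ) :
      UTyping c Φ Ω .zero (.fin .zero) .nil (.list A .zero)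
  | cons {Δ G σ} {Φ : List (Fm Δ)} {Ω : UEnv Δ G} {A : UTy Δ σ} {I k₁ k₂ : Idx Δ}
      {l₁ l₂ : UB Δ} {t₁ : Exp G σ} {t₂ : Exp G (.list σ)}
      (h₁ : UTyping c Φ Ω k₁ l₁ t₁ A) (h₂ : UTyping c Φ Ω k₂ l₂ t₂ (.list A I)) :
      UTyping c Φ Ω (add k₁ k₂) (l₁.add l₂) (.cons t₁ t₂) (.list A (.succ I))
  | caseL {Δ G σ τ} {Φ : List (Fm Δ)} {Ω : UEnv Δ G} {A : UTy Δ σ} {B : UTy Δ τ}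
      {I k k' : Idx Δ} {l l' : UB Δ} {t : Exp G (.list σ)} {t₁ : Exp G τ}
      {t₂ : Exp (.list σ :: σ :: G) τ}
      (h : UTyping c Φ Ω k l t (.list A I))
      (h₁ : UTyping c (.eq I .zero :: Φ) Ω k' l' t₁ B)
      (h₂ : UTyping c (.eq I.wk (.succ v0) :: wkAll (σ := Ty.nat) Φ)
        (.cons (.list A.wk v0) (.cons A.wk Ω.wk)) k'.wk l'.wk t₂ B.wk) :
      UTyping c Φ Ω (add (add k k') (num c.cCase)) ((l.add l').add (.fin (num c.cCase)))
        (.caseL t t₁ t₂) B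
  | sub {Δ G σ} {Φ : List (Fm Δ)} {Ω : UEnv Δ G} {A A' : UTy Δ σ} {k k' : Idx Δ} {l l' : UB Δ}
      {t : Exp G σ} (h : UTyping c Φ Ω k l t A) (hA : USub Φ A A') (hk : HOL Φ (.le k' k))
      (hl : HOL Φ (l.le l')) : UTyping c Φ Ω k' l' t A'
  | split {Δ G σ} {Φ : List (Fm Δ)} {Ω : UEnv Δ G} {A : UTy Δ σ} {k : Idx Δ} {l : UB Δ}
      {t : Exp G σ} {C C' : Fm Δ} (hC : HOL Φ (.or C C'))
      (h : UTyping c (C :: Φ) Ω k l t A) (h' : UTyping c (C' :: Φ) Ω k l t A) :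
      UTyping c Φ Ω k l t A
  | contra {Δ G σ} {Φ : List (Fm Δ)} {Ω : UEnv Δ G} {A : UTy Δ σ} {k : Idx Δ} {l : UB Δ}
      {t : Exp G σ} (hC : HOL Φ .bot) : UTyping c Φ Ω k l t A

/-! ## The context of the translated judgment -/

/-- The context `‖|Ω|‖, Δ` of the translated judgment. -/
abbrev transCtx (G : List STy) (Δ : Ctx) : Ctx := G.map STy.cv ++ Δ

/-- Positions of the program variables in the translated context. -/
def progVar {Δ : Ctx} : ∀ {G : List STy}, VMap G (transCtx G Δ)
  | _ :: _, _, .z => .z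
  | _ :: _, _, .s x => .s (progVar x)

/-- Positions of the index variables in the translated context. -/
def idxVar {Δ : Ctx} : ∀ {G : List STy}, Ren Δ (transCtx G Δ)
  | [], _, x => x
  | _ :: _, _, x => .s (idxVar x)

end RelCost

namespace RelCost

/-! ## Substitution calculus -/

/-! The UHOL judgment splits into a HOL fact and a trivial UHOL fact. Subsumption only asks for a
HOL implication about the term itself, so if UHOL derives `⊤` for a term, then every assertion that
HOL proves of that term is derivable for it (`UHOL.of_total`). Translated terms do satisfy `⊤`, by
induction on the expression (`Exp.cost_total`): the only recursive definition they contain is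
addition, which is guarded.

What remains is that HOL proves `⌊A⌋ₑ` of the translated term. This is `UTyping.exp_sound`, by
induction on the typing derivation. It is stated as for a logical relation: for any PCF context, any
interpretation of the index variables by terms, any placement of the program variables, and any
hypotheses from which the instances of `Φ` and `⌊Ω⌋` are derivable. In each case the translated term
is provably equal to a pair of a value and a sum of costs, by `β`- and `ι`-steps, so the value
predicate and the two cost bounds can be checked separately. The bounds need commutativity and
associativity of addition and monotonicity of `≤`, proved by induction inside HOL. Subsumption needs
soundness of subtyping (`USub.val_mono`), whose list case is an internal induction on the size
(`HOL.listU_mono`).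

Entailments over the index variables are moved into the translated context by closure of HOL under
substitution (`HOL.subst_incl`, `HOL.substAll`). That rests on closure of conversion under
substitution, hence on stability of the guard condition, because the `μ`-rule fires only for guarded
definitions. -/

theorem Ren.lift_comp {Γ Δ Θ : Ctx} {σ : Ty} (r : Ren Γ Δ) (r' : Ren Δ Θ) :
    (fun τ (x : Var (σ :: Γ) τ) => (Ren.lift r') ((Ren.lift r) x)) =
      Ren.lift (fun _ x => r' (r x)) := by
  funext τ x; cases x <;> rfl

theorem Tm.rename_rename {Γ : Ctx} {τ : Ty} (t : Tm Γ τ) :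
    ∀ {Δ Θ : Ctx} (r : Ren Γ Δ) (r' : Ren Δ Θ),
      (t.rename r).rename r' = t.rename (fun _ x => r' (r x)) := by
  induction t <;> intros <;> simp only [Tm.rename, Ren.lift_comp, *]

theorem Sub.lift_ofRen {Γ Δ : Ctx} {σ : Ty} (r : Ren Γ Δ) :
    (Sub.ofRen r).lift (σ := σ) = Sub.ofRen r.lift := by
  funext τ x; cases x <;> rfl

-- Eliminates renamings in favour of substitutions, so that `simp` works in a single calculus.
@[simp] theorem Tm.rename_eq_subst {Γ : Ctx} {τ : Ty} (t : Tm Γ τ) :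
    ∀ {Δ : Ctx} (r : Ren Γ Δ), t.rename r = t.subst (Sub.ofRen r) := by
  induction t <;> intros <;> simp only [Tm.rename, Tm.subst, Sub.lift_ofRen, *]; rfl

/-- Composition of substitutions, in diagrammatic order. -/
def Sub.comp {Γ Δ Θ : Ctx} (s : Sub Γ Δ) (s' : Sub Δ Θ) : Sub Γ Θ := fun _ x => (s x).subst s'

/-- The two mixed compositions must precede `Tm.subst_subst`: `Sub.lift` weakens by a renaming, so
pushing a substitution under a binder meets a renaming on either side. -/
theorem Tm.subst_rename_left {Γ : Ctx} {τ : Ty} (t : Tm Γ τ) :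
    ∀ {Δ Θ : Ctx} (r : Ren Γ Δ) (s : Sub Δ Θ),
      (t.rename r).subst s = t.subst (fun _ x => s (r x)) := by
  have key : ∀ {Γ Δ Θ : Ctx} {σ : Ty} (r : Ren Γ Δ) (s : Sub Δ Θ),
      (fun τ (x : Var (σ :: Γ) τ) => (Sub.lift s) ((Ren.lift r) x)) =
      Sub.lift (fun _ x => s (r x)) := by
    intros; funext τ x; cases x <;> rfl
  induction t <;> intros <;> simp only [Tm.rename, Tm.subst, *]

theorem Tm.wk_rename {Γ Δ : Ctx} {σ τ : Ty} (t : Tm Γ τ) (r : Ren Γ Δ) :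
    (t.wk (σ := σ)).rename r.lift = (t.rename r).wk := by
  simp only [Tm.wk, Tm.rename_rename]; rfl

theorem Tm.subst_rename {Γ : Ctx} {τ : Ty} (t : Tm Γ τ) :
    ∀ {Δ Θ : Ctx} (s : Sub Γ Δ) (r : Ren Δ Θ),
      (t.subst s).rename r = t.subst (fun _ x => (s x).rename r) := by
  have key : ∀ {Γ Δ Θ : Ctx} {σ : Ty} (s : Sub Γ Δ) (r : Ren Δ Θ),
      (fun τ (x : Var (σ :: Γ) τ) => ((Sub.lift s) x).rename r.lift) =
      Sub.lift (fun _ x => (s x).rename r) := by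
    intros; funext τ x; cases x
    · rfl
    · exact Tm.wk_rename _ _
  induction t <;> intros <;> simp only [Tm.rename, Tm.subst, *]

theorem Tm.wk_subst_lift {Γ Δ : Ctx} {σ τ : Ty} (t : Tm Γ τ) (s : Sub Γ Δ) :
    (t.wk (σ := σ)).subst s.lift = (t.subst s).wk := by
  simp only [Tm.wk, Tm.subst_rename_left, Tm.subst_rename]; rfl

theorem Sub.lift_comp {Γ Δ Θ : Ctx} {σ : Ty} (s : Sub Γ Δ) (s' : Sub Δ Θ) :
    (s.lift (σ := σ)).comp s'.lift = (s.comp s').lift := by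
  funext τ x; cases x
  · rfl
  · exact Tm.wk_subst_lift _ _

@[simp] theorem Tm.subst_subst {Γ : Ctx} {τ : Ty} (t : Tm Γ τ) :
    ∀ {Δ Θ : Ctx} (s : Sub Γ Δ) (s' : Sub Δ Θ), (t.subst s).subst s' = t.subst (s.comp s') := by
  induction t <;> intros <;> simp only [Tm.subst, Sub.lift_comp, *]; rfl

/-- The identity substitution. -/
def Sub.id {Γ : Ctx} : Sub Γ Γ := fun _ x => .var x

theorem Sub.lift_id {Γ : Ctx} {σ : Ty} : (Sub.id (Γ := Γ)).lift (σ := σ) = Sub.id := by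
  funext τ x; cases x <;> rfl

@[simp] theorem Tm.subst_id {Γ : Ctx} {τ : Ty} (t : Tm Γ τ) : t.subst Sub.id = t := by
  induction t <;> simp only [Tm.subst, Sub.lift_id, *]; rfl

@[simp] theorem Tm.wk_eq {Γ : Ctx} {σ τ : Ty} (t : Tm Γ τ) :
    t.wk (σ := σ) = t.subst (Sub.ofRen up1) := Tm.rename_eq_subst _ _

@[simp] theorem Fm.subst_subst {Γ : Ctx} (φ : Fm Γ) :
    ∀ {Δ Θ : Ctx} (s : Sub Γ Δ) (s' : Sub Δ Θ), (φ.subst s).subst s' = φ.subst (s.comp s') := by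
  induction φ <;> intros <;> simp only [Fm.subst, Sub.lift_comp, Tm.subst_subst, *]

@[simp] theorem Fm.subst_id {Γ : Ctx} (φ : Fm Γ) : φ.subst Sub.id = φ := by
  induction φ <;> simp only [Fm.subst, Sub.lift_id, Tm.subst_id, *]

@[simp] theorem Fm.wk_eq {Γ : Ctx} {σ : Ty} (φ : Fm Γ) :
    φ.wk (σ := σ) = φ.subst (Sub.ofRen up1) := rfl

/-! Rewrite rules for compositions of substitutions. -/

@[simp] theorem Sub.cons_comp {Γ Δ Θ : Ctx} {σ : Ty} (s : Sub Γ Δ) (t : Tm Δ σ) (s' : Sub Δ Θ) :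
    (s.cons t).comp s' = (s.comp s').cons (t.subst s') := by
  funext τ x; cases x <;> rfl

-- Together with the neighbouring rules this is the `σ`-calculus of explicit substitutions:
-- everything is rewritten to `cons` over compositions with the shift `up1`, and `simp` then proves
-- the substitution identities needed below.
@[simp] theorem Sub.lift_eq {Γ Δ : Ctx} {σ : Ty} (s : Sub Γ Δ) :
    s.lift (σ := σ) = (s.comp (Sub.ofRen up1)).cons v0 := by
  funext τ x; cases x
  · rfl
  · exact Tm.wk_eq _

@[simp] theorem Sub.wk_eq {Γ Δ : Ctx} {σ : Ty} (s : Sub Γ Δ) :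
    s.wk (σ := σ) = s.comp (Sub.ofRen up1) := by
  funext τ x; exact Tm.wk_eq _

@[simp] theorem Sub.one_eq {Γ : Ctx} {σ : Ty} (t : Tm Γ σ) : Sub.one t = Sub.cons Sub.id t := rfl

@[simp] theorem Sub.comp_assoc {Γ Δ Θ Ξ : Ctx} (s : Sub Γ Δ) (s' : Sub Δ Θ) (s'' : Sub Θ Ξ) :
    (s.comp s').comp s'' = s.comp (s'.comp s'') := by
  funext τ x; exact Tm.subst_subst _ _ _

@[simp] theorem Sub.comp_id {Γ Δ : Ctx} (s : Sub Γ Δ) : s.comp Sub.id = s := by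
  funext τ x; exact Tm.subst_id _

@[simp] theorem Sub.id_comp {Γ Δ : Ctx} (s : Sub Γ Δ) : Sub.id.comp s = s := rfl

@[simp] theorem Sub.up1_cons {Γ Δ : Ctx} {σ : Ty} (s : Sub Γ Δ) (t : Tm Δ σ) :
    (Sub.ofRen up1).comp (s.cons t) = s := rfl

@[simp] theorem Sub.up2_eq {Γ : Ctx} {σ σ' : Ty} :
    Sub.ofRen (up2 (Γ := Γ) (σ := σ) (σ' := σ')) = (Sub.ofRen up1).comp (Sub.ofRen up1) := rfl

@[simp] theorem Sub.up3_eq {Γ : Ctx} {σ σ' σ'' : Ty} :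
    Sub.ofRen (up3 (Γ := Γ) (σ := σ) (σ' := σ') (σ'' := σ'')) =
      (Sub.ofRen up1).comp ((Sub.ofRen up1).comp (Sub.ofRen up1)) := rfl

@[simp] theorem v0_cons {Γ Δ : Ctx} {σ : Ty} (s : Sub Γ Δ) (t : Tm Δ σ) :
    v0.subst (s.cons t) = t := rfl

@[simp] theorem v1_cons {Γ Δ : Ctx} {σ τ : Ty} (s : Sub (σ :: Γ) Δ) (t : Tm Δ τ) :
    v1.subst (s.cons t) = v0.subst s := rfl

@[simp] theorem v2_cons {Γ Δ : Ctx} {σ τ τ' : Ty} (s : Sub (τ :: σ :: Γ) Δ) (t : Tm Δ τ') :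
    v2.subst (s.cons t) = v1.subst s := rfl

@[simp] theorem v0_up1 {Γ : Ctx} {σ τ : Ty} :
    (v0 (Γ := Γ) (τ := τ)).subst (Sub.ofRen (up1 (σ := σ))) = v1 := rfl

@[simp] theorem v1_up1 {Γ : Ctx} {σ τ τ' : Ty} :
    (v1 (Γ := Γ) (τ := τ) (τ₀ := τ')).subst (Sub.ofRen (up1 (σ := σ))) = v2 := rfl

@[simp] theorem Sub.cons_id {Γ : Ctx} {σ : Ty} :
    (Sub.ofRen (up1 (Γ := Γ) (σ := σ))).cons v0 = Sub.id := by
  funext τ x; cases x <;> rfl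

@[simp] theorem Sub.ofRen_lift {Γ Δ : Ctx} {σ : Ty} (r : Ren Γ Δ) :
    Sub.ofRen (r.lift (σ := σ)) = ((Sub.ofRen r).comp (Sub.ofRen up1)).cons v0 := by
  funext τ x; cases x <;> rfl

@[simp] theorem Sub.ofRen_s {Γ : Ctx} {σ : Ty} :
    (Sub.ofRen (fun τ (x : Var Γ τ) => Var.s (σ := σ) x)) = Sub.ofRen up1 := rfl

@[simp] theorem Sub.cons_z {Γ Δ : Ctx} {σ : Ty} (s : Sub Γ Δ) (t : Tm Δ σ) :
    (s.cons t) Var.z = t := rfl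

@[simp] theorem Sub.cons_s {Γ Δ : Ctx} {σ τ : Ty} (s : Sub Γ Δ) (t : Tm Δ σ) (x : Var Γ τ) :
    (s.cons t) (Var.s x) = s x := rfl

@[simp] theorem Sub.ofRen_apply {Γ Δ : Ctx} {τ : Ty} (r : Ren Γ Δ) (x : Var Γ τ) :
    Sub.ofRen r x = Tm.var (r x) := rfl

@[simp] theorem up1_apply {Γ : Ctx} {σ τ : Ty} (x : Var Γ τ) : up1 (σ := σ) x = Var.s x := rfl

@[simp] theorem var_s_z {Γ : Ctx} {σ τ : Ty} : (Tm.var (.s .z) : Tm (τ :: σ :: Γ) σ) = v1 := rfl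

@[simp] theorem v0_up1_comp {Γ Δ : Ctx} {σ τ : Ty} (s : Sub (τ :: σ :: Γ) Δ) :
    v0.subst ((Sub.ofRen up1).comp s) = v1.subst s := rfl

@[simp] theorem v1_up1_comp {Γ Δ : Ctx} {σ τ τ' : Ty} (s : Sub (τ' :: τ :: σ :: Γ) Δ) :
    v1.subst ((Sub.ofRen up1).comp s) = v2.subst s := rfl

@[simp] theorem v2_up1 {Γ : Ctx} {σ τ τ' τ'' : Ty} :
    (v2 (Γ := Γ) (τ := τ) (τ₀ := τ') (τ₁ := τ'')).subst (Sub.ofRen (up1 (σ := σ))) =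
      .var (.s (.s (.s .z))) := rfl

@[simp] theorem Sub.comp_apply {Γ Δ Θ : Ctx} {τ : Ty} (s : Sub Γ Δ) (s' : Sub Δ Θ)
    (x : Var Γ τ) : (s.comp s') x = (s x).subst s' := rfl

@[simp] theorem Sub.id_apply {Γ : Ctx} {τ : Ty} (x : Var Γ τ) : Sub.id x = Tm.var x := rfl

attribute [simp] Fm.inst Fm.rename Tm.subst Fm.subst

/-! ## Stability of the guard condition, conversion and derivability under substitution -/

/-- Renamings come first because lifting a role-respecting substitution weakens its terms, and these
must stay guarded. -/
theorem Guard.rename {Γ : Ctx} {τ : Ty} {R : Roles Γ} {t : Tm Γ τ} (h : Guard R t) :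
    ∀ {Δ : Ctx} {R' : Roles Δ} (r : Ren Γ Δ), (∀ σ (x : Var Γ σ), R' (r x) = R x) →
      Guard R' (t.rename r) := by
  have key : ∀ {Γ Δ : Ctx} {R : Roles Γ} {R' : Roles Δ} {r : Ren Γ Δ},
      (∀ σ (x : Var Γ σ), R' (r x) = R x) → ∀ {σ' : Ty} {a : Role} (σ) (x : Var (σ' :: Γ) σ),
        (R'.ext a) (r.lift x) = (R.ext a) x := by
    intro Γ Δ R R' r h σ' a σ x
    cases x
    · rfl
    · exact h _ _
  induction h with
  | var h => intro Δ R' r hr; exact .var (by rwa [hr])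
  | call hf hy => intro Δ R' r hr; exact .call (by rwa [hr]) (by rwa [hr])
  | caseNatSmall hy _ _ ihu ihv =>
    intro Δ R' r hr
    exact .caseNatSmall (by rwa [hr]) (ihu r hr) (ihv r.lift (key hr))
  | caseListSmall hy _ _ ihu ihv =>
    intro Δ R' r hr
    exact .caseListSmall (by rwa [hr]) (ihu r hr) (ihv r.lift.lift (key (key hr)))
  | pair _ _ iht ihu => intro Δ R' r hr; exact .pair (iht r hr) (ihu r hr)
  | fst _ iht => intro Δ R' r hr; exact .fst (iht r hr)
  | snd _ iht => intro Δ R' r hr; exact .snd (iht r hr)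
  | app _ _ iht ihu => intro Δ R' r hr; exact .app (iht r hr) (ihu r hr)
  | lam _ iht => intro Δ R' r hr; exact .lam (iht r.lift (key hr))
  | tt => intros; exact .tt
  | ff => intros; exact .ff
  | zero => intros; exact .zero
  | nil => intros; exact .nil
  | succ _ iht => intro Δ R' r hr; exact .succ (iht r hr)
  | cons _ _ iht ihu => intro Δ R' r hr; exact .cons (iht r hr) (ihu r hr)
  | caseNat _ _ _ iht ihu ihv =>
    intro Δ R' r hr; exact .caseNat (iht r hr) (ihu r hr) (ihv r hr)
  | caseBool _ _ _ iht ihu ihv =>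
    intro Δ R' r hr; exact .caseBool (iht r hr) (ihu r hr) (ihv r hr)
  | caseList _ _ _ iht ihu ihv =>
    intro Δ R' r hr; exact .caseList (iht r hr) (ihu r hr) (ihv r hr)
  | letrec _ ih => intro Δ R' r hr; exact .letrec (ih r.lift.lift (key (key hr)))

/-- Terms without occurrences of the recursive function are guarded. -/
theorem Guard.of_no_fn {Γ : Ctx} {τ : Ty} (t : Tm Γ τ) :
    ∀ {R : Roles Γ}, (∀ σ (x : Var Γ σ), R x ≠ Role.fn) → Guard R t := by
  have key : ∀ {Γ : Ctx} {R : Roles Γ}, (∀ σ (x : Var Γ σ), R x ≠ Role.fn) →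
      ∀ {σ' : Ty} (σ) (x : Var (σ' :: Γ) σ), (R.ext Role.plain) x ≠ Role.fn := by
    intro Γ R h σ' σ x
    cases x
    · exact fun h => nomatch h
    · exact h _ _
  induction t with
  | var x => intro R h; exact .var (h _ x)
  | pair _ _ i j => intro R h; exact .pair (i h) (j h)
  | fst _ i => intro R h; exact .fst (i h)
  | snd _ i => intro R h; exact .snd (i h)
  | app _ _ i j => intro R h; exact .app (i h) (j h)
  | lam _ i => intro R h; exact .lam (i (key h))
  | tt => intros; exact .tt
  | ff => intros; exact .ff
  | zero => intros; exact .zero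
  | nil => intros; exact .nil
  | succ _ i => intro R h; exact .succ (i h)
  | cons _ _ i j => intro R h; exact .cons (i h) (j h)
  | caseNat _ _ _ i j k => intro R h; exact .caseNat (i h) (j h) (k h)
  | caseBool _ _ _ i j k => intro R h; exact .caseBool (i h) (j h) (k h)
  | caseList _ _ _ i j k => intro R h; exact .caseList (i h) (j h) (k h)
  | letrec _ _ i => intro R h; exact .letrec (i (key (key h)))

/-- Substitutions that respect roles: special variables are mapped to variables of the same role,
and the others to guarded terms. -/
def Sub.Respects {Γ Δ : Ctx} (R : Roles Γ) (R' : Roles Δ) (s : Sub Γ Δ) : Prop :=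
  ∀ σ (x : Var Γ σ), (R x ≠ Role.plain → ∃ y, s x = Tm.var y ∧ R' y = R x) ∧
    (R x = Role.plain → Guard R' (s x))

theorem Sub.Respects.lift {Γ Δ : Ctx} {R : Roles Γ} {R' : Roles Δ} {s : Sub Γ Δ}
    (h : s.Respects R R') {σ : Ty} {a : Role} :
    (s.lift (σ := σ)).Respects (R.ext a) (R'.ext a) := by
  intro τ x
  cases x with
  | z => exact ⟨fun _ => ⟨.z, rfl, rfl⟩, fun (ha : a = _) =>
      .var (R := R'.ext a) (fun (h' : a = _) => by rw [ha] at h'; cases h')⟩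
  | s x =>
    refine ⟨fun hx => ?_, fun hx => ?_⟩
    · obtain ⟨y, hy, hR⟩ := (h _ x).1 hx
      exact ⟨.s y, by change (s x).wk = _; rw [hy]; rfl, hR⟩
    · exact ((h _ x).2 hx).rename _ (fun _ _ => rfl)

/-- The rules for recursive calls and for case analysis on the argument require literal variables. A
role-respecting substitution sends variables with such roles to variables, so these rules still
apply to the result. -/
theorem Guard.subst {Γ : Ctx} {τ : Ty} {R : Roles Γ} {t : Tm Γ τ} (h : Guard R t) :
    ∀ {Δ : Ctx} {R' : Roles Δ} {s : Sub Γ Δ}, s.Respects R R' → Guard R' (t.subst s) := by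
  induction h with
  | @var Γ τ R x h =>
    intro Δ R' s hs
    by_cases hx : R x = Role.plain
    · exact (hs _ x).2 hx
    · obtain ⟨y, hy, hR⟩ := (hs _ x).1 hx
      rw [Tm.subst, hy]
      exact .var (by rwa [hR])
  | @call Γ I σ R f y hf hy =>
    intro Δ R' s hs
    obtain ⟨f', hf', hRf⟩ := (hs _ f).1 (by simp [hf])
    obtain ⟨y', hy', hRy⟩ := (hs _ y).1 (by simp [hy])
    rw [Tm.subst, Tm.subst, Tm.subst, hf', hy']
    exact .call (by rwa [hRf]) (by rwa [hRy])
  | @caseNatSmall Γ τ R y u v hy _ _ ihu ihv =>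
    intro Δ R' s hs
    obtain ⟨y', hy', hRy⟩ := (hs _ y).1 (by rcases hy with hy | hy <;> simp [hy])
    rw [Tm.subst, Tm.subst, Tm.subst, hy']
    exact .caseNatSmall (by rwa [hRy]) (ihu hs) (ihv hs.lift)
  | @caseListSmall Γ σ τ R y u v hy _ _ ihu ihv =>
    intro Δ R' s hs
    obtain ⟨y', hy', hRy⟩ := (hs _ y).1 (by rcases hy with hy | hy <;> simp [hy])
    rw [Tm.subst, Tm.subst, Tm.subst, Tm.subst, hy']
    exact .caseListSmall (by rwa [hRy]) (ihu hs) (ihv hs.lift.lift)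
  | pair _ _ iht ihu => intro Δ R' s hr; exact .pair (iht hr) (ihu hr)
  | fst _ iht => intro Δ R' s hr; exact .fst (iht hr)
  | snd _ iht => intro Δ R' s hr; exact .snd (iht hr)
  | app _ _ iht ihu => intro Δ R' s hr; exact .app (iht hr) (ihu hr)
  | lam _ iht => intro Δ R' s hr; exact .lam (iht hr.lift)
  | tt => intros; exact .tt
  | ff => intros; exact .ff
  | zero => intros; exact .zero
  | nil => intros; exact .nil
  | succ _ iht => intro Δ R' s hr; exact .succ (iht hr)
  | cons _ _ iht ihu => intro Δ R' s hr; exact .cons (iht hr) (ihu hr)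
  | caseNat _ _ _ iht ihu ihv => intro Δ R' s hr; exact .caseNat (iht hr) (ihu hr) (ihv hr)
  | caseBool _ _ _ iht ihu ihv => intro Δ R' s hr; exact .caseBool (iht hr) (ihu hr) (ihv hr)
  | caseList _ _ _ iht ihu ihv => intro Δ R' s hr; exact .caseList (iht hr) (ihu hr) (ihv hr)
  | letrec _ ih => intro Δ R' s hr; exact .letrec (ih hr.lift.lift)

/-- The free variables of a recursive definition are all plain, and the terms put in their place
cannot mention the function being defined; the two bound variables keep their roles under lifting.
-/
theorem WDef.subst {Γ Δ : Ctx} {I σ : Ty} {e : Tm (I :: Ty.arr I σ :: Γ) σ} (h : WDef e)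
    (s : Sub Γ Δ) : WDef (e.subst s.lift.lift) := by
  refine Guard.subst h (Sub.Respects.lift (Sub.Respects.lift ?_))
  intro τ x
  exact ⟨fun h => (h rfl).elim, fun _ => .of_no_fn _ (fun _ _ h => nomatch h)⟩

theorem IsCon.subst {Γ Δ : Ctx} {τ : Ty} {t : Tm Γ τ} (h : IsCon t) (s : Sub Γ Δ) :
    IsCon (t.subst s) := by
  cases h <;> constructor

theorem Step.cast {Γ : Ctx} {τ : Ty} {t u u' : Tm Γ τ} (h : Step t u) (e : u = u') :
    Step t u' := e ▸ h

theorem Step.subst {Γ : Ctx} {τ : Ty} {t u : Tm Γ τ} (h : Step t u) :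
    ∀ {Δ : Ctx} (s : Sub Γ Δ), Step (t.subst s) (u.subst s) := by
  induction h with
  | beta t u => intro Δ s; exact (Step.beta _ _).cast (by simp)
  | mu hI e t he ht =>
    intro Δ s
    exact (Step.mu hI _ _ (he.subst s) (ht.subst s)).cast (by simp [Tm.subst])
  | fstPair => intros; exact .fstPair _ _
  | sndPair => intros; exact .sndPair _ _
  | caseNatZero => intros; exact .caseNatZero _ _
  | caseNatSucc => intros; exact .caseNatSucc _ _ _
  | caseBoolTt => intros; exact .caseBoolTt _ _
  | caseBoolFf => intros; exact .caseBoolFf _ _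
  | caseListNil => intros; exact .caseListNil _ _
  | caseListCons => intros; exact .caseListCons _ _ _ _
  | pairL _ ih => intro Δ s; exact .pairL (ih s)
  | pairR _ ih => intro Δ s; exact .pairR (ih s)
  | fst _ ih => intro Δ s; exact .fst (ih s)
  | snd _ ih => intro Δ s; exact .snd (ih s)
  | appL _ ih => intro Δ s; exact .appL (ih s)
  | appR _ ih => intro Δ s; exact .appR (ih s)
  | lam _ ih => intro Δ s; exact .lam (ih _)
  | succ _ ih => intro Δ s; exact .succ (ih s)
  | consL _ ih => intro Δ s; exact .consL (ih s)
  | consR _ ih => intro Δ s; exact .consR (ih s)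
  | caseNat1 _ ih => intro Δ s; exact .caseNat1 (ih s)
  | caseNat2 _ ih => intro Δ s; exact .caseNat2 (ih s)
  | caseNat3 _ ih => intro Δ s; exact .caseNat3 (ih s)
  | caseBool1 _ ih => intro Δ s; exact .caseBool1 (ih s)
  | caseBool2 _ ih => intro Δ s; exact .caseBool2 (ih s)
  | caseBool3 _ ih => intro Δ s; exact .caseBool3 (ih s)
  | caseList1 _ ih => intro Δ s; exact .caseList1 (ih s)
  | caseList2 _ ih => intro Δ s; exact .caseList2 (ih s)
  | caseList3 _ ih => intro Δ s; exact .caseList3 (ih s)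
  | letrec _ ih => intro Δ s; exact .letrec (ih _)

theorem Conv.subst {Γ Δ : Ctx} {τ : Ty} {t u : Tm Γ τ} (h : Conv t u) (s : Sub Γ Δ) :
    Conv (t.subst s) (u.subst s) := by
  induction h with
  | rel _ _ h => exact .rel _ _ (h.subst s)
  | refl => exact .refl _
  | symm _ _ _ ih => exact .symm _ _ ih
  | trans _ _ _ _ _ ih ih' => exact .trans _ _ _ ih ih'

/-- The rules produce formulas with substitutions in unreduced form; this transports a derivation
along an equality that is usually left to `simp`. -/
theorem HOL.cast {Γ : Ctx} {Ψ Ψ' : List (Fm Γ)} {φ φ' : Fm Γ} (h : HOL Ψ φ) (e : φ = φ')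
    (e' : Ψ = Ψ' := by rfl) : HOL Ψ' φ' := e' ▸ e ▸ h

theorem size_subst {Γ Δ : Ctx} {I : Ty} (hI : Ind I) (t : Tm Γ I) (s : Sub Γ Δ) :
    (size hI t).subst s = size hI (t.subst s) := by
  cases hI <;> rfl

@[simp] theorem add_subst {Γ Δ : Ctx} (t u : Tm Γ Ty.nat) (s : Sub Γ Δ) :
    (add t u).subst s = add (t.subst s) (u.subst s) := rfl

@[simp] theorem num_subst {Γ Δ : Ctx} (n : ℕ) (s : Sub Γ Δ) : (num n).subst s = num n := by
  induction n with
  | zero => rfl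
  | succ n ih => simp only [num, Tm.subst, ih]

@[simp] theorem Fm.le_subst {Γ Δ : Ctx} (t u : Tm Γ Ty.nat) (s : Sub Γ Δ) :
    (Fm.le t u).subst s = Fm.le (t.subst s) (u.subst s) := by
  simp [Fm.le, Fm.subst]

/-- `Ψ'` contains the instances of all assertions of `Ψ` under `s`. -/
def SubIncl {Γ Δ : Ctx} (s : Sub Γ Δ) (Ψ : List (Fm Γ)) (Ψ' : List (Fm Δ)) : Prop :=
  ∀ φ ∈ Ψ, φ.subst s ∈ Ψ'

theorem SubIncl.cons {Γ Δ : Ctx} {s : Sub Γ Δ} {Ψ : List (Fm Γ)} {Ψ' : List (Fm Δ)}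
    (h : SubIncl s Ψ Ψ') {φ : Fm Γ} {φ' : Fm Δ} (e : φ.subst s = φ') :
    SubIncl s (φ :: Ψ) (φ' :: Ψ') := by
  intro ψ hψ
  rcases List.mem_cons.1 hψ with rfl | hψ
  · simp [e]
  · exact List.mem_cons_of_mem _ (h _ hψ)

theorem SubIncl.wk {Γ Δ : Ctx} {s : Sub Γ Δ} {Ψ : List (Fm Γ)} {Ψ' : List (Fm Δ)}
    (h : SubIncl s Ψ Ψ') {σ : Ty} :
    SubIncl (s.lift (σ := σ)) (wkAll Ψ) (wkAll Ψ') := by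
  intro ψ hψ
  obtain ⟨φ, hφ, rfl⟩ := List.mem_map.1 hψ
  exact List.mem_map.2 ⟨_, h φ hφ, by simp⟩

/-- Asking only that the instances of the hypotheses be contained in `Ψ'` makes one induction yield
substitution, weakening by variables and monotonicity in the hypotheses. -/
theorem HOL.subst_incl {Γ : Ctx} {Ψ : List (Fm Γ)} {φ : Fm Γ} (h : HOL Ψ φ) :
    ∀ {Δ : Ctx} {s : Sub Γ Δ} {Ψ' : List (Fm Δ)}, SubIncl s Ψ Ψ' → HOL Ψ' (φ.subst s) := by
  induction h with
  | ax h => intro Δ s Ψ' hs; exact .ax (hs _ h)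
  | conv h => intro Δ s Ψ' hs; exact .conv (h.subst s)
  | @subst Γ τ Ψ φ t u _ _ ih ih' =>
    intro Δ s Ψ' hs
    exact (HOL.subst (φ.subst s.lift) (t := t.subst s) (u := u.subst s)
      ((ih hs).cast (by simp)) (ih' hs)).cast (by simp)
  | topI => intros; exact .topI
  | botE _ _ ih => intro Δ s Ψ' hs; exact .botE _ (ih hs)
  | impI _ ih => intro Δ s Ψ' hs; exact .impI (ih (hs.cons rfl))
  | impE _ _ ih ih' => intro Δ s Ψ' hs; exact .impE (ih hs) (ih' hs)
  | andI _ _ ih ih' => intro Δ s Ψ' hs; exact .andI (ih hs) (ih' hs)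
  | andE1 _ ih => intro Δ s Ψ' hs; exact .andE1 (ih hs)
  | andE2 _ ih => intro Δ s Ψ' hs; exact .andE2 (ih hs)
  | orI1 _ ih => intro Δ s Ψ' hs; exact .orI1 (ih hs)
  | orI2 _ ih => intro Δ s Ψ' hs; exact .orI2 (ih hs)
  | orE _ _ _ ih ih₁ ih₂ =>
    intro Δ s Ψ' hs; exact .orE (ih hs) (ih₁ (hs.cons rfl)) (ih₂ (hs.cons rfl))
  | allI _ ih => intro Δ s Ψ' hs; exact .allI (ih hs.wk)
  | allE _ t ih => intro Δ s Ψ' hs; exact (HOL.allE (ih hs) (t.subst s)).cast (by simp)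
  | exI t _ ih => intro Δ s Ψ' hs; exact .exI (t.subst s) ((ih hs).cast (by simp))
  | exE _ _ ih ih' =>
    intro Δ s Ψ' hs; exact .exE (ih hs) ((ih' (hs.wk.cons rfl)).cast (by simp))
  | boolInd _ _ ih ih' =>
    intro Δ s Ψ' hs
    exact .boolInd ((ih hs).cast (by simp [Tm.subst])) ((ih' hs).cast (by simp [Tm.subst]))
  | natInd _ _ ih ih' =>
    intro Δ s Ψ' hs
    exact .natInd ((ih hs).cast (by simp [Tm.subst]))
      ((ih' (hs.wk.cons rfl)).cast (by simp [Tm.subst]))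
  | @listInd Γ τ Ψ φ _ _ ih ih' =>
    intro Δ s Ψ' hs
    exact .listInd ((ih hs).cast (by simp [Tm.subst]))
      ((ih' (hs.wk.wk.cons (φ' := (φ.subst s.lift).subst ((Sub.ofRen up2).cons v0))
        (by simp))).cast (by simp [Tm.subst]))
  | strongInd hI _ ih =>
    intro Δ s Ψ' hs
    exact .strongInd hI (ih (hs.wk.cons
      (by simp [Fm.subst, Fm.lt, size_subst, Tm.subst])))
  | ncBool => intros; exact .ncBool
  | ncNat t => intros; exact .ncNat _
  | ncList h t => intros; exact .ncList _ _
  | succInj _ ih => intro Δ s Ψ' hs; exact .succInj (ih hs)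
  | consInj1 _ ih => intro Δ s Ψ' hs; exact .consInj1 (ih hs)
  | consInj2 _ ih => intro Δ s Ψ' hs; exact .consInj2 (ih hs)
  | listUZero l φ => intros; exact .listUZero _ _
  | listUSucc n l φ =>
    intro Δ s Ψ' hs
    exact (HOL.listUSucc (n.subst s) (l.subst s) (φ.subst s.lift)).cast
      (by simp [Fm.subst, Fm.iff, Tm.subst])

theorem HOL.mono {Γ : Ctx} {Ψ Ψ' : List (Fm Γ)} {φ : Fm Γ} (h : HOL Ψ φ)
    (hs : ∀ ψ ∈ Ψ, ψ ∈ Ψ') : HOL Ψ' φ :=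
  (h.subst_incl (s := Sub.id) (fun ψ hψ => by simpa using hs ψ hψ)).cast (by simp)

theorem HOL.weaken {Γ : Ctx} {Ψ : List (Fm Γ)} {φ ψ : Fm Γ} (h : HOL Ψ φ) : HOL (ψ :: Ψ) φ :=
  h.mono (fun _ h => List.mem_cons_of_mem _ h)

theorem HOL.wk {Γ : Ctx} {Ψ : List (Fm Γ)} {φ : Fm Γ} (h : HOL Ψ φ) {σ : Ty} :
    HOL (wkAll (σ := σ) Ψ) (φ.subst (Sub.ofRen up1)) :=
  h.subst_incl (fun _ h => List.mem_map.2 ⟨_, h, rfl⟩)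

/-- The hypotheses are turned into implications one at a time, and each is eliminated by its
derivation from `Ψ'`. -/
theorem HOL.cut {Γ : Ctx} {Ψ Ψ' : List (Fm Γ)} {φ : Fm Γ} (h : HOL Ψ φ)
    (hs : ∀ ψ ∈ Ψ, HOL Ψ' ψ) : HOL Ψ' φ := by
  induction Ψ generalizing φ with
  | nil => exact h.mono (by simp)
  | cons ψ Ψ ih =>
    exact .impE (ih (.impI h) (fun χ hχ => hs χ (List.mem_cons_of_mem _ hχ)))
      (hs ψ (List.mem_cons_self ..))

/-- The form used for index entailments: in the translated context the instances of `Φ` need only be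
derivable, not literally present. -/
theorem HOL.substAll {Γ Δ : Ctx} {Ψ : List (Fm Γ)} {φ : Fm Γ} (h : HOL Ψ φ) {s : Sub Γ Δ}
    {Ψ' : List (Fm Δ)} (hs : ∀ ψ ∈ Ψ, HOL Ψ' (ψ.subst s)) : HOL Ψ' (φ.subst s) :=
  (h.subst_incl (s := s) (Ψ' := Ψ.map (·.subst s)) (fun _ h => List.mem_map_of_mem h)).cut
    (fun χ hχ => by
      obtain ⟨ψ, hψ, rfl⟩ := List.mem_map.1 hχ
      exact hs ψ hψ)

/-! ## Equality -/

section Equality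

variable {Γ : Ctx} {Ψ : List (Fm Γ)}

theorem HOL.refl {τ : Ty} (t : Tm Γ τ) : HOL Ψ (.eq t t) := .conv (.refl _)

theorem HOL.symm {τ : Ty} {t u : Tm Γ τ} (h : HOL Ψ (.eq t u)) : HOL Ψ (.eq u t) :=
  (HOL.subst (.eq v0 t.wk) ((HOL.refl t).cast (by simp)) h).cast
    (by simp)

theorem HOL.trans {τ : Ty} {t u v : Tm Γ τ} (h : HOL Ψ (.eq t u)) (h' : HOL Ψ (.eq u v)) :
    HOL Ψ (.eq t v) :=
  (HOL.subst (.eq t.wk v0) (h.cast (by simp)) h').cast (by simp)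

theorem HOL.step {τ : Ty} {t u : Tm Γ τ} (h : Step t u) : HOL Ψ (.eq t u) :=
  .conv (.rel _ _ h)

/-- Congruence: equal terms may be replaced in a term with a hole. -/
theorem HOL.congr {σ τ : Ty} (f : Tm (σ :: Γ) τ) {t u : Tm Γ σ} (h : HOL Ψ (.eq t u)) :
    HOL Ψ (.eq (f.subst (Sub.one t)) (f.subst (Sub.one u))) :=
  (HOL.subst (.eq (f.subst (Sub.one t)).wk f)
    ((HOL.refl (f.subst (Sub.one t))).cast (by simp)) h).cast (by simp)

theorem HOL.congrFst {σ τ : Ty} {t u : Tm Γ (.prod σ τ)} (h : HOL Ψ (.eq t u)) :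
    HOL Ψ (.eq t.fst u.fst) := HOL.congr (.fst v0) h

theorem HOL.congrSnd {σ τ : Ty} {t u : Tm Γ (.prod σ τ)} (h : HOL Ψ (.eq t u)) :
    HOL Ψ (.eq t.snd u.snd) := HOL.congr (.snd v0) h

theorem HOL.congrSucc {t u : Tm Γ .nat} (h : HOL Ψ (.eq t u)) :
    HOL Ψ (.eq t.succ u.succ) := HOL.congr (.succ v0) h

theorem HOL.congrApp {σ τ : Ty} {t t' : Tm Γ (.arr σ τ)} {u u' : Tm Γ σ}
    (h : HOL Ψ (.eq t t')) (h' : HOL Ψ (.eq u u')) : HOL Ψ (.eq (t.app u) (t'.app u')) :=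
  HOL.trans (u := t'.app u) ((HOL.congr (.app v0 u.wk) h).cast (by simp))
    ((HOL.congr (.app t'.wk v0) h').cast (by simp))

theorem HOL.congrAdd {t t' u u' : Tm Γ .nat}
    (h : HOL Ψ (.eq t t')) (h' : HOL Ψ (.eq u u')) : HOL Ψ (.eq (add t u) (add t' u')) :=
  .congrApp (.congrApp (.refl _) h) h'

theorem HOL.congrCaseList {σ τ : Ty} {t t' : Tm Γ (.list σ)} {u : Tm Γ τ}
    {v : Tm Γ (.arr σ (.arr (.list σ) τ))} (h : HOL Ψ (.eq t t')) :
    HOL Ψ (.eq (.caseList t u v) (.caseList t' u v)) :=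
  (HOL.congr (.caseList v0 u.wk v.wk) h).cast (by simp)

/-! ## Induction and case analysis on natural numbers -/

theorem HOL.natIndOn (φ : Fm (Ty.nat :: Γ)) (t : Tm Γ .nat) (hz : HOL Ψ (φ.inst .zero))
    (hs : HOL (φ :: wkAll Ψ) (φ.subst ((Sub.ofRen up1).cons (.succ v0)))) :
    HOL Ψ (φ.inst t) := (HOL.natInd hz hs).allE t

theorem HOL.exElim {τ : Ty} {φ : Fm (τ :: Γ)} {χ : Fm Γ} (h : HOL Ψ (.ex τ φ))
    (h' : HOL (φ :: wkAll Ψ) (χ.subst (Sub.ofRen up1))) : HOL Ψ χ := .exE h h'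

/-- Induction whose step ignores the induction hypothesis. It serves to split on the size of a list
in the case rule. -/
theorem HOL.natCases (t : Tm Γ .nat) {χ : Fm Γ} (hz : HOL (.eq t .zero :: Ψ) χ)
    (hs : HOL (.eq t.wk (.succ v0) :: wkAll Ψ) (χ.subst (Sub.ofRen up1))) : HOL Ψ χ := by
  have h : HOL Ψ (.or (.eq t .zero) (.ex .nat (.eq t.wk (.succ v0)))) :=
    (HOL.natIndOn (.or (.eq v0 .zero) (.ex .nat (.eq v1 (.succ v0)))) t
      (.orI1 (.refl _)) (.orI2 (.exI v0 (.refl _)))).cast (by simp)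
  exact .orE h hz (.exElim (.ax (List.mem_cons_self ..)) (hs.mono (by simp +contextual [wkAll])))

end Equality

/-! ## Arithmetic -/

section Arithmetic

variable {Γ : Ctx} {Ψ : List (Fm Γ)}

/-- The function `n ↦ t + n`. -/
def addTo (t : Tm Γ .nat) : Tm Γ (.arr .nat .nat) :=
  .letrec Ind.nat (.caseNat v0 (t.subst (Sub.ofRen up2)) (.lam (.succ (.app v2 v0))))

/-- The weakened `t` cannot mention the recursive function, and the only call is on the predecessor
bound by case analysis on the argument. -/
theorem addTo_wdef (t : Tm Γ .nat) : WDef (Γ := Γ) (I := .nat) (σ := .nat) (.caseNat v0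
    (t.subst (Sub.ofRen up2)) (.lam (.succ (.app v2 v0)))) :=
  .caseNatSmall (.inl rfl) ((Tm.rename_eq_subst t up2) ▸ (Guard.of_no_fn t
    (R := fun _ _ => Role.plain) (fun _ _ h => nomatch h)).rename _ (fun _ _ => rfl))
    (.succ (.call rfl rfl))

/-- One `β`-step exposes the `letrec` to which the `μ`-rule applies when the second summand is a
constructor. -/
theorem HOL.add_eq (t u : Tm Γ .nat) : HOL Ψ (.eq (add t u) (.app (addTo t) u)) :=
  .step (.appL ((Step.beta _ _).cast (by simp [addTo])))

theorem HOL.add_zero (t : Tm Γ .nat) : HOL Ψ (.eq (add t .zero) t) := by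
  refine (HOL.add_eq t _).trans (.trans (.step (.mu _ _ _ (addTo_wdef t) .zero)) ?_)
  simp
  exact HOL.step (.caseNatZero _ _)

theorem HOL.add_succ (t u : Tm Γ .nat) :
    HOL Ψ (.eq (add t (.succ u)) (.succ (add t u))) := by
  refine (HOL.add_eq t _).trans (.trans (.step (.mu _ _ _ (addTo_wdef t) (.succ _))) ?_)
  refine .trans (.step (.caseNatSucc _ _ _)) (.trans (.step (.beta _ _)) ?_)
  refine (HOL.congrSucc (HOL.add_eq t u).symm).cast ?_
  simp [addTo]

/-- Addition recurses on its second argument, so the equations for the first one are not conversions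
and need induction. -/
theorem HOL.zero_add (t : Tm Γ .nat) : HOL Ψ (.eq (add .zero t) t) := by
  refine (HOL.natIndOn (.eq (add .zero v0) v0) t (.add_zero _) ?_).cast (by simp)
  exact (HOL.add_succ _ _).trans (.congrSucc (.ax (List.mem_cons_self ..)))

theorem HOL.succ_add (t u : Tm Γ .nat) :
    HOL Ψ (.eq (add (.succ t) u) (.succ (add t u))) := by
  refine (HOL.natIndOn (.eq (add (.succ t.wk) v0) (.succ (add t.wk v0))) u ?_ ?_).cast (by simp)
  · simp
    exact (HOL.add_zero _).trans (.congrSucc (.symm (.add_zero _)))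
  · simp
    exact .trans (.add_succ _ _) (.trans (.congrSucc (.ax (List.mem_cons_self ..)))
      (.congrSucc (.symm (.add_succ _ _))))

theorem HOL.add_comm (t u : Tm Γ .nat) : HOL Ψ (.eq (add t u) (add u t)) := by
  refine (HOL.natIndOn (.eq (add t.wk v0) (add v0 t.wk)) u ?_ ?_).cast (by simp)
  · simp
    exact (HOL.add_zero _).trans (.symm (.zero_add _))
  · simp
    exact .trans (.add_succ _ _) (.trans (.congrSucc (.ax (List.mem_cons_self ..)))
      (.symm (.succ_add _ _)))

theorem HOL.add_assoc (t u v : Tm Γ .nat) :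
    HOL Ψ (.eq (add (add t u) v) (add t (add u v))) := by
  refine (HOL.natIndOn (.eq (add (add t.wk u.wk) v0) (add t.wk (add u.wk v0))) v ?_ ?_).cast
    (by simp)
  · simp
    exact (HOL.add_zero _).trans (.congrAdd (.refl _) (.symm (.add_zero _)))
  · simp
    exact .trans (.add_succ _ _) (.trans (.congrSucc (.ax (List.mem_cons_self ..)))
      (.symm (.trans (.congrAdd (.refl _) (.add_succ _ _)) (.add_succ _ _))))

/-- Regroups a sum of two inequalities so that their witnesses add up. -/
theorem HOL.add_add_add_comm (a b d e : Tm Γ .nat) :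
    HOL Ψ (.eq (add (add a b) (add d e)) (add (add a d) (add b e))) := by
  refine (HOL.add_assoc _ _ _).trans (.trans (.congrAdd (.refl _) ?_) (.symm (.add_assoc _ _ _)))
  exact .trans (.symm (.add_assoc _ _ _))
    (.trans (.congrAdd (.add_comm _ _) (.refl _)) (.add_assoc _ _ _))

theorem HOL.le_intro {t u : Tm Γ .nat} (d : Tm Γ .nat) (h : HOL Ψ (.eq (add t d) u)) :
    HOL Ψ (.le t u) := .exI d (h.cast (by simp))

theorem HOL.le_of_eq {t u : Tm Γ .nat} (h : HOL Ψ (.eq t u)) : HOL Ψ (.le t u) :=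
  .le_intro .zero ((HOL.add_zero _).trans h)

theorem HOL.le_refl (t : Tm Γ .nat) : HOL Ψ (.le t t) := .le_of_eq (.refl _)

theorem HOL.le_trans {t u v : Tm Γ .nat} (h : HOL Ψ (.le t u)) (h' : HOL Ψ (.le u v)) :
    HOL Ψ (.le t v) := by
  refine .exElim h (.exElim (h'.wk.weaken.cast (Fm.le_subst _ _ _)) ?_)
  simp
  -- The differences witnessing the two inequalities are `v1` and `v0`; their sum witnesses the
  -- composite.
  refine HOL.le_intro (add v1 v0) (.trans (.symm (.add_assoc _ _ _)) (.trans (.congrAdd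
    (t' := u.wk.wk) (.ax ?_) (.refl _)) (.ax ?_))) <;> simp [wkAll]

theorem HOL.add_le_add {a b a' b' : Tm Γ .nat} (h : HOL Ψ (.le a b)) (h' : HOL Ψ (.le a' b')) :
    HOL Ψ (.le (add a a') (add b b')) := by
  refine .exElim h (.exElim (h'.wk.weaken.cast (Fm.le_subst _ _ _)) ?_)
  simp
  refine HOL.le_intro (add v1 v0) (.trans (.add_add_add_comm _ _ _ _)
    (.congrAdd (.ax ?_) (.ax ?_))) <;> simp [wkAll]

end Arithmetic

/-! ## The predicate `listU` -/

section ListU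

variable {Γ : Ctx} {Ψ : List (Fm Γ)} {τ : Ty}

theorem HOL.listU_zero_intro {l : Tm Γ (.list τ)} {φ : Fm (τ :: Γ)} (h : HOL Ψ (.eq l .nil)) :
    HOL Ψ (.listU .zero l φ) := .impE (.andE2 (.listUZero l φ)) h

theorem HOL.listU_zero_elim {l : Tm Γ (.list τ)} {φ : Fm (τ :: Γ)}
    (h : HOL Ψ (.listU .zero l φ)) : HOL Ψ (.eq l .nil) := .impE (.andE1 (.listUZero l φ)) h

theorem HOL.listU_succ_intro {n : Tm Γ .nat} {l : Tm Γ (.list τ)} {φ : Fm (τ :: Γ)}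
    (a : Tm Γ τ) (b : Tm Γ (.list τ)) (h : HOL Ψ (.eq l (.cons a b))) (ha : HOL Ψ (φ.inst a))
    (hb : HOL Ψ (.listU n b φ)) : HOL Ψ (.listU (.succ n) l φ) := by
  refine .impE (.andE2 (.listUSucc n l φ)) (.exI a (.exI b (.andI ?_ (.andI ?_ ?_))))
  · exact h.cast (by simp)
  · exact ha.cast (by simp)
  · exact hb.cast (by simp)

/-- Unfolding axiom as an elimination rule: head and tail become the variables `v1` and `v0`, and
the three conjuncts become separate hypotheses, recovered by a cut. -/
theorem HOL.listU_succ_elim {n : Tm Γ .nat} {l : Tm Γ (.list τ)} {φ : Fm (τ :: Γ)} {χ : Fm Γ}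
    (h : HOL Ψ (.listU (.succ n) l φ))
    (h' : HOL (.listU n.wk.wk v0 (φ.rename (up2 (σ := Ty.list τ) (σ' := τ)).lift) ::
      φ.subst ((Sub.ofRen up2).cons v1) :: .eq l.wk.wk (.cons v1 v0) :: wkAll (wkAll Ψ))
      (χ.subst (Sub.ofRen up2))) : HOL Ψ χ := by
  refine .exElim (.impE (.andE1 (.listUSucc n l φ)) h)
    (.exElim (.ax (List.mem_cons_self ..)) (HOL.cast (h'.cut ?_) (by simp)))
  have hd := fun Ψ => HOL.ax (Ψ := _ :: Ψ) (List.mem_cons_self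
    (a := (Fm.and (.eq l.wk.wk (.cons v1 v0))
            (.and (φ.subst ((Sub.ofRen up2).cons v1))
              (.listU n.wk.wk v0 (φ.rename (up2 (σ := Ty.list τ) (σ' := τ)).lift))))))
  simp only [List.mem_cons]
  rintro ψ (rfl | rfl | rfl | hψ)
  · exact .andE2 (.andE2 (hd _))
  · exact .andE1 (.andE2 (hd _))
  · exact .andE1 (hd _)
  · exact .ax (List.mem_cons_of_mem _ (List.mem_map.2 (by
      obtain ⟨χ, hχ, rfl⟩ := List.mem_map.1 hψ
      exact ⟨χ, List.mem_cons_of_mem _ hχ, rfl⟩)))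

theorem HOL.listU_congr {n n' : Tm Γ .nat} {l l' : Tm Γ (.list τ)} {φ : Fm (τ :: Γ)}
    (h : HOL Ψ (.listU n l φ)) (hn : HOL Ψ (.eq n n')) (hl : HOL Ψ (.eq l l')) :
    HOL Ψ (.listU n' l' φ) := by
  have h' : HOL Ψ (.listU n' l φ) :=
    (HOL.subst (.listU v0 l.wk (φ.subst (Sub.ofRen up1).lift)) (h.cast (by simp))
      hn).cast (by simp)
  exact (HOL.subst (.listU n'.wk v0 (φ.subst (Sub.ofRen up1).lift)) (h'.cast (by simp))
      hl).cast (by simp)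

theorem HOL.listU_mono {n : Tm Γ .nat} {l : Tm Γ (.list τ)} {φ φ' : Fm (τ :: Γ)}
    (h : HOL Ψ (.listU n l φ)) (hφ : HOL (φ :: wkAll Ψ) φ') : HOL Ψ (.listU n l φ') := by
  -- The list is quantified inside the induction on the size, since the induction hypothesis is
  -- needed for the tail.
  have key : HOL Ψ ((Fm.all (.list τ) (.imp
      (.listU v1 v0 (φ.subst (Sub.ofRen up2).lift))
      (.listU v1 v0 (φ'.subst (Sub.ofRen up2).lift)))).inst n) := by
    refine HOL.natIndOn _ n (.allI (.impI ?_)) (.allI (.impI ?_))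
    · exact .listU_zero_intro (.listU_zero_elim (.ax (List.mem_cons_self ..)))
    · simp
      refine .listU_succ_elim (.ax (List.mem_cons_self ..)) ?_
      simp
      refine .listU_succ_intro v1 v0 (.ax (by simp)) ?_ ?_
      -- Four variables have been added: the size, the list, its head and its tail. The element in
      -- `hφ` is instantiated by the head `v1`.
      · refine (hφ.substAll (s := (Sub.comp (Sub.ofRen up2) (Sub.ofRen up2)).cons v1) ?_).cast
          (by simp)
        simp only [List.mem_cons, wkAll, List.mem_map]
        rintro ψ (rfl | ⟨ψ, hψ, rfl⟩)
        · exact .ax (by simp)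
        · exact .ax (by simp; exact .inr (.inr (.inr (.inr (.inr ⟨ψ, hψ, rfl⟩)))))
      -- The induction hypothesis at the tail `v0`; index 3 is the size, and index 4 is the same
      -- variable under the quantifier over lists.
      · refine .impE (φ := .listU (.var (.s (.s (.s .z)))) v0 (φ.subst (Sub.lift (Sub.comp
            (Sub.ofRen up2) (Sub.ofRen up2))))) (HOL.cast (HOL.allE (φ := Fm.imp
            (.listU (.var (.s (.s (.s (.s .z))))) v0 (φ.subst (Sub.lift (Sub.comp
              (Sub.ofRen up2) (Sub.ofRen up3)))))
            (.listU (.var (.s (.s (.s (.s .z))))) v0 (φ'.subst (Sub.lift (Sub.comp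
              (Sub.ofRen up2) (Sub.ofRen up3)))))) (.ax ?_) v0) (by simp)) (.ax ?_) <;>
          simp [wkAll]
  exact .impE ((key.allE l).cast (by simp)) h

end ListU

/-! ## Substitution in the predicates of unary types -/

theorem UB.subst_subst {Δ Δ' Δ'' : Ctx} (l : UB Δ) (s : Sub Δ Δ') (s' : Sub Δ' Δ'') :
    (l.subst s).subst s' = l.subst (s.comp s') := by
  cases l <;> simp [UB.subst]

theorem Fm.leUB_subst {Γ Δ : Ctx} (t : Tm Γ .nat) (l : UB Γ) (s : Sub Γ Δ) :
    (Fm.leUB t l).subst s = Fm.leUB (t.subst s) (l.subst s) := by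
  cases l <;> simp [UB.subst, Fm.leUB]

theorem UB.add_subst {Δ Δ' : Ctx} (l l' : UB Δ) (s : Sub Δ Δ') :
    (l.add l').subst s = (l.subst s).add (l'.subst s) := by
  cases l <;> cases l' <;> rfl

theorem UB.le_subst {Δ Δ' : Ctx} (l l' : UB Δ) (s : Sub Δ Δ') :
    (l.le l').subst s = (l.subst s).le (l'.subst s) := by
  cases l <;> cases l' <;> simp [UB.le, UB.subst]

/-- Substitution in the PCF context commutes with the predicate: it acts on the interpretation of
the index variables and on the subject, never on the type. -/
theorem UTy.val_subst {Δ : Ctx} {σ : STy} (A : UTy Δ σ) :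
    ∀ {Γ Γ' : Ctx} (s : Sub Δ Γ) (x : Tm Γ σ.cv) (s' : Sub Γ Γ'),
      (A.val s x).subst s' = A.val (s.comp s') (x.subst s') := by
  induction A with
  | nat => intros; rfl
  | list A I ih => intros; simp [UTy.val, ih]; rfl
  | arr A k l B ihA ihB =>
    intro Γ Γ' s x s'
    -- The translated type must be unfolded to an arrow before the application in the predicate can
    -- be rewritten.
    change Tm Γ (.arr _ (.prod _ .nat)) at x
    change Fm.subst (.all _ (.imp (A.val s.wk v0) (expSpec (fun y => B.val s.wk y) (k.subst s.wk)
      (l.subst s.wk) (.app x.wk v0)))) s' = .all _ (.imp (A.val (s.comp s').wk v0)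
        (expSpec (fun y => B.val (s.comp s').wk y) (k.subst (s.comp s').wk)
          (l.subst (s.comp s').wk) (.app (x.subst s').wk v0)))
    simp [expSpec, ihA, ihB, Fm.leUB_subst, UB.subst_subst]
  | all k l A ih =>
    intro Γ Γ' s x s'
    change Tm Γ (.arr .nat (.prod _ .nat)) at x
    change Fm.subst (.all .nat (.imp .top (.all .nat (expSpec (fun y => A.val (s.wk.wk.cons v0) y)
      (k.subst (s.wk.wk.cons v0)) (l.subst (s.wk.wk.cons v0)) (.app x.wk.wk v1))))) s' =
      .all .nat (.imp .top (.all .nat (expSpec (fun y => A.val ((s.comp s').wk.wk.cons v0) y)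
        (k.subst ((s.comp s').wk.wk.cons v0)) (l.subst ((s.comp s').wk.wk.cons v0))
          (.app (x.subst s').wk.wk v1))))
    simp [expSpec, ih, Fm.leUB_subst, UB.subst_subst]

theorem UTy.exp_subst {Δ : Ctx} {σ : STy} (A : UTy Δ σ) (k : Idx Δ) (l : UB Δ) {Γ Γ' : Ctx}
    (s : Sub Δ Γ) (x : Tm Γ σ.ce) (s' : Sub Γ Γ') :
    (A.exp k l s x).subst s' = A.exp k l (s.comp s') (x.subst s') := by
  simp [UTy.exp, expSpec, UTy.val_subst, Fm.leUB_subst, UB.subst_subst]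

/-- The counterpart for index terms substituted in the type: they are absorbed into the
interpretation. Index application and weakening of types both use this. -/
theorem UTy.val_tySubst {Δ : Ctx} {σ : STy} (A : UTy Δ σ) :
    ∀ {Δ' Γ : Ctx} (s : Sub Δ Δ') (s' : Sub Δ' Γ) (x : Tm Γ σ.cv),
      (A.subst s).val s' x = A.val (s.comp s') x := by
  induction A with
  | nat => intros; rfl
  | list A I ih => intros; simp [UTy.val, UTy.subst, ih]
  | arr A k l B ihA ihB => intros; simp [UTy.val, UTy.subst, ihA, ihB, UB.subst_subst]
  | all k l A ih => intros; simp [UTy.val, UTy.subst, ih, UB.subst_subst]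

theorem UTy.exp_tySubst {Δ : Ctx} {σ : STy} (A : UTy Δ σ) (k : Idx Δ) (l : UB Δ) {Δ' Γ : Ctx}
    (s : Sub Δ Δ') (s' : Sub Δ' Γ) (x : Tm Γ σ.ce) :
    (A.subst s).exp (k.subst s) (l.subst s) s' x = A.exp k l (s.comp s') x := by
  simp [UTy.exp, UTy.val_tySubst, UB.subst_subst]

/-! ## Derivability of the predicates -/

section Predicates

variable {Δ Γ : Ctx} {Ψ : List (Fm Γ)} {s : Sub Δ Γ} {σ τ : STy}

/-- Allows the subject to be replaced along provable equalities, in particular along reductions of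
translated terms. -/
theorem HOL.val_congr {A : UTy Δ σ} {x y : Tm Γ σ.cv} (h : HOL Ψ (A.val s x))
    (e : HOL Ψ (.eq x y)) : HOL Ψ (A.val s y) :=
  (HOL.subst (A.val s.wk v0) (h.cast (by simp [UTy.val_subst])) e).cast
    (by simp [UTy.val_subst])

theorem HOL.val_wk {A : UTy Δ σ} {x : Tm Γ σ.cv} (h : HOL Ψ (A.val s x)) {ρ : Ty} :
    HOL (wkAll (σ := ρ) Ψ) (A.val s.wk x.wk) := h.wk.cast (by simp [UTy.val_subst])

theorem HOL.exp_wk {A : UTy Δ σ} {k : Idx Δ} {l : UB Δ} {x : Tm Γ σ.ce}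
    (h : HOL Ψ (A.exp k l s x)) {ρ : Ty} :
    HOL (wkAll (σ := ρ) Ψ) (A.exp k l s.wk x.wk) := h.wk.cast (by simp [UTy.exp_subst])

theorem HOL.exp_congr {A : UTy Δ σ} {k : Idx Δ} {l : UB Δ} {x y : Tm Γ σ.ce}
    (h : HOL Ψ (A.exp k l s x)) (e : HOL Ψ (.eq x y)) : HOL Ψ (A.exp k l s y) :=
  (HOL.subst (A.exp k l s.wk v0) (h.cast (by simp [UTy.exp_subst])) e).cast
    (by simp [UTy.exp_subst])

theorem HOL.leUB_trans {a b : Tm Γ .nat} {l : UB Γ} (h : HOL Ψ (.le a b))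
    (h' : HOL Ψ (.leUB b l)) : HOL Ψ (.leUB a l) := by
  cases l with
  | fin => exact h.le_trans h'
  | inf => exact .topI

theorem HOL.leUB_mono {a : Tm Γ .nat} {l l' : UB Γ} (h : HOL Ψ (.leUB a l))
    (h' : HOL Ψ (l.le l')) : HOL Ψ (.leUB a l') := by
  cases l' with
  | inf => exact .topI
  | fin => cases l with
    | fin => exact HOL.le_trans h h'
    | inf => exact .botE _ h'

theorem HOL.leUB_add {a b : Tm Γ .nat} {l l' : UB Γ} (h : HOL Ψ (.leUB a l))
    (h' : HOL Ψ (.leUB b l')) : HOL Ψ (.leUB (add a b) (l.add l')) := by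
  cases l with
  | inf => exact .topI
  | fin => cases l' with
    | fin => exact HOL.add_le_add h h'
    | inf => exact .topI

theorem HOL.exp_val {A : UTy Δ σ} {k : Idx Δ} {l : UB Δ} {x : Tm Γ σ.ce}
    (h : HOL Ψ (A.exp k l s x)) : HOL Ψ (A.val s x.fst) := .andE1 h

theorem HOL.exp_lower {A : UTy Δ σ} {k : Idx Δ} {l : UB Δ} {x : Tm Γ σ.ce}
    (h : HOL Ψ (A.exp k l s x)) : HOL Ψ (.le (k.subst s) x.snd) := .andE1 (.andE2 h)

theorem HOL.exp_upper {A : UTy Δ σ} {k : Idx Δ} {l : UB Δ} {x : Tm Γ σ.ce}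
    (h : HOL Ψ (A.exp k l s x)) : HOL Ψ (.leUB x.snd (l.subst s)) := .andE2 (.andE2 h)

/-- Common last step of the typing rules: once a translated term is provably a pair, its value and
its cost are treated independently. -/
theorem HOL.exp_of_eq_pair {A : UTy Δ σ} {k : Idx Δ} {l : UB Δ} {x : Tm Γ σ.ce}
    {v : Tm Γ σ.cv} {n : Tm Γ .nat} (e : HOL Ψ (.eq x (.pair v n))) (hv : HOL Ψ (A.val s v))
    (hk : HOL Ψ (.le (k.subst s) n)) (hl : HOL Ψ (.leUB n (l.subst s))) :
    HOL Ψ (A.exp k l s x) := by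
  have hn : HOL Ψ (.eq n x.snd) := (e.congrSnd.trans (.step (.sndPair _ _))).symm
  exact .andI (hv.val_congr (e.congrFst.trans (.step (.fstPair _ _))).symm)
    (.andI (hk.le_trans (.le_of_eq hn)) (HOL.leUB_trans (.le_of_eq hn.symm) hl))

theorem HOL.exp_pure {A : UTy Δ σ} {v : Tm Γ σ.cv} (hv : HOL Ψ (A.val s v)) :
    HOL Ψ (A.exp .zero (.fin .zero) s (.pair v .zero)) :=
  .exp_of_eq_pair (.refl _) hv (.le_refl _) (.le_refl _)

theorem HOL.arr_intro {A : UTy Δ σ} {k : Idx Δ} {l : UB Δ} {B : UTy Δ τ}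
    {f : Tm Γ (.arr σ.cv (.prod τ.cv .nat))}
    (h : HOL (A.val s.wk v0 :: wkAll Ψ) (B.exp k l s.wk (.app f.wk v0))) :
    HOL Ψ ((UTy.arr A k l B).val s f) := .allI (.impI h)

theorem HOL.arr_elim {A : UTy Δ σ} {k : Idx Δ} {l : UB Δ} {B : UTy Δ τ}
    {f : Tm Γ (.arr σ.cv (.prod τ.cv .nat))} {x : Tm Γ σ.cv} (h : HOL Ψ ((UTy.arr A k l B).val s f))
    (hx : HOL Ψ (A.val s x)) : HOL Ψ (B.exp k l s (.app f x)) := by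
  refine .impE ((HOL.allE (φ := .imp (A.val s.wk v0) (B.exp k l s.wk (.app f.wk v0))) h x).cast
    ?_) hx
  simp [UTy.val_subst, UTy.exp_subst]

theorem HOL.all_intro {k : Idx (.nat :: Δ)} {l : UB (.nat :: Δ)} {A : UTy (.nat :: Δ) σ}
    {f : Tm Γ (.arr .nat (.prod σ.cv .nat))}
    (h : HOL (wkAll (.top :: wkAll Ψ)) (A.exp k l (s.wk.wk.cons v0) (.app f.wk.wk v1))) :
    HOL Ψ ((UTy.all k l A).val s f) := .allI (.impI (.allI h))

/-- The dummy argument `y` and the index `i` are instantiated independently: the translation always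
passes `0`, whereas the predicate is needed at an arbitrary index term. -/
theorem HOL.all_elim {k : Idx (.nat :: Δ)} {l : UB (.nat :: Δ)} {A : UTy (.nat :: Δ) σ}
    {f : Tm Γ (.arr .nat (.prod σ.cv .nat))} (h : HOL Ψ ((UTy.all k l A).val s f)) (y i : Tm Γ .nat) :
    HOL Ψ (A.exp k l (s.cons i) (.app f y)) := by
  have h' := HOL.allE (τ := .nat) (φ := .imp .top (.all .nat (A.exp k l (s.wk.wk.cons v0)
    (.app f.wk.wk v1)))) h y
  refine (HOL.allE (.impE h' .topI) i).cast ?_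
  simp [UTy.exp_subst]

/-! ## Satisfaction of assertions on index variables -/

/-- The instances under `s` of all assertions of `Φ` are derivable from `Ψ`. -/
def Sat (Ψ : List (Fm Γ)) (s : Sub Δ Γ) (Φ : List (Fm Δ)) : Prop :=
  ∀ φ ∈ Φ, HOL Ψ (φ.subst s)

variable {Φ : List (Fm Δ)}

theorem Sat.weaken (h : Sat Ψ s Φ) {φ : Fm Γ} : Sat (φ :: Ψ) s Φ :=
  fun φ hφ => (h φ hφ).weaken

theorem Sat.wk (h : Sat Ψ s Φ) {ρ : Ty} : Sat (wkAll (σ := ρ) Ψ) s.wk Φ :=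
  fun φ hφ => (h φ hφ).wk.cast (by simp)

theorem Sat.consIdx (h : Sat Ψ s Φ) {ρ : Ty} (t : Tm Γ ρ) : Sat Ψ (s.cons t) (wkAll Φ) := by
  intro ψ hψ
  obtain ⟨φ, hφ, rfl⟩ := List.mem_map.1 hψ
  exact (h φ hφ).cast (by simp)

theorem Sat.cons (h : Sat Ψ s Φ) {φ : Fm Δ} (hφ : HOL Ψ (φ.subst s)) : Sat Ψ s (φ :: Φ) := by
  intro ψ hψ
  rcases List.mem_cons.1 hψ with rfl | hψ
  · exact hφ
  · exact h _ hψ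

/-- The cost bounds follow from `k' ≤ k ≤ π₂ x ≤ l ≤ l'`, where the outer inequalities are
transported from `Φ` along `s`. -/
theorem HOL.exp_mono {A A' : UTy Δ σ} {k k' : Idx Δ} {l l' : UB Δ} {x : Tm Γ σ.ce}
    (hA : ∀ y, HOL Ψ (A.val s y) → HOL Ψ (A'.val s y)) (hs : Sat Ψ s Φ)
    (hk : HOL Φ (.le k' k)) (hl : HOL Φ (l.le l')) (h : HOL Ψ (A.exp k l s x)) :
    HOL Ψ (A'.exp k' l' s x) :=
  .andI (hA _ h.exp_val) (.andI
    (((hk.substAll hs).cast (Fm.le_subst _ _ _)).le_trans h.exp_lower)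
    (h.exp_upper.leUB_mono ((hl.substAll hs).cast (UB.le_subst _ _ _))))

end Predicates

/-- Soundness of subtyping. -/
theorem USub.val_mono {Δ : Ctx} {σ : STy} {Φ : List (Fm Δ)} {A A' : UTy Δ σ}
    (h : USub Φ A A') : ∀ {Γ : Ctx} {Ψ : List (Fm Γ)} {s : Sub Δ Γ}, Sat Ψ s Φ →
      ∀ x, HOL Ψ (A.val s x) → HOL Ψ (A'.val s x) := by
  induction h with
  | refl => intro Γ Ψ s _ x h; exact h
  | trans _ _ ih ih' => intro Γ Ψ s hs x h; exact ih' hs x (ih hs x h)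
  | list _ hI ih =>
    intro Γ Ψ s hs x h
    -- The equality of sizes is used first; then subtyping of the elements is applied to a fresh
    -- element.
    exact (HOL.listU_congr h (hI.substAll hs) (.refl _)).listU_mono
      (ih hs.wk.weaken v0 (.ax (List.mem_cons_self ..)))
  | @arr Δ σ τ Φ A A' B B' k k' l l' _ _ hk hl ihA ihB =>
    intro Γ Ψ s hs x h
    -- Contravariance: an argument satisfying the predicate of `A'` also satisfies that of `A`, so
    -- the function may be applied to it; the result then moves from `B` to `B'`.
    refine .arr_intro (HOL.exp_mono (ihB hs.wk.weaken) hs.wk.weaken hk hl (.arr_elim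
      (A := A) ?_ (ihA hs.wk.weaken _ (.ax (List.mem_cons_self ..)))))
    exact h.val_wk.weaken
  | all _ hk hl ih =>
    intro Γ Ψ s hs x h
    -- Below the dummy argument (`v1`) and the index (`v0`), the index variable bound by the type is
    -- interpreted as `v0`.
    have hs' := (hs.wk (ρ := .nat)).weaken (φ := .top) |>.wk (ρ := .nat) |>.consIdx
      (ρ := .nat) v0
    refine .all_intro (HOL.exp_mono (ih hs') hs' hk hl (.all_elim ?_ v1 v0))
    exact h.val_wk.weaken.val_wk

/-! ## The cost translation -/

theorem VMap.lift_ren {G : List STy} {Γ Γ' : Ctx} {σ : STy} (r : VMap G Γ) (ρ : Ren Γ Γ') :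
    (fun τ (x : Var (σ :: G) τ) => (Ren.lift ρ) ((VMap.lift r) x)) =
      VMap.lift (fun _ x => ρ (r x)) := by
  funext τ x; cases x <;> rfl

theorem VMap.wk_ren {G : List STy} {Γ Γ' : Ctx} {τ : Ty} (r : VMap G Γ) (ρ : Ren Γ Γ') :
    (fun σ (x : Var G σ) => (Ren.lift ρ) ((VMap.wk (τ := τ) r) x)) =
      VMap.wk (fun _ x => ρ (r x)) := rfl

/-- The term of the translation of a case analysis, for given translations of its parts. -/
def caseCost {Γ : Ctx} {σ τ : Ty} (n : ℕ) (T : Tm Γ (.prod (.list σ) .nat))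
    (T₁ : Tm (.prod (.list σ) .nat :: Γ) (.prod τ .nat))
    (T₂ : Tm (.list σ :: σ :: .prod (.list σ) .nat :: Γ) (.prod τ .nat)) :
    Tm Γ (.prod τ .nat) :=
  letIn T (.caseList (.fst v0)
    (letIn T₁ (.pair (.fst v0) (add (add (.snd v1) (.snd v0)) (num n))))
    (.lam (.lam (letIn T₂ (.pair (.fst v0)
      (add (add (.snd (.var (.s (.s (.s .z))))) (.snd v0)) (num n)))))))

theorem caseCost_subst {Γ Γ' : Ctx} {σ τ : Ty} (n : ℕ) (T : Tm Γ (.prod (.list σ) .nat))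
    (T₁ : Tm (.prod (.list σ) .nat :: Γ) (.prod τ .nat))
    (T₂ : Tm (.list σ :: σ :: .prod (.list σ) .nat :: Γ) (.prod τ .nat)) (s : Sub Γ Γ') :
    (caseCost n T T₁ T₂).subst s =
      caseCost n (T.subst s) (T₁.subst s.lift) (T₂.subst s.lift.lift.lift) := by
  simp [caseCost, letIn]

theorem caseCost_congr {Γ : Ctx} {σ τ : Ty} {n : ℕ} {T T' : Tm Γ (.prod (.list σ) .nat)}
    {T₁ T₁' : Tm (.prod (.list σ) .nat :: Γ) (.prod τ .nat)}
    {T₂ T₂' : Tm (.list σ :: σ :: .prod (.list σ) .nat :: Γ) (.prod τ .nat)}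
    (h : T = T') (h₁ : T₁ = T₁') (h₂ : T₂ = T₂') : caseCost n T T₁ T₂ = caseCost n T' T₁' T₂' := by
  rw [h, h₁, h₂]

/-- The translation depends on its context only through the positions of the program variables, so a
renaming just moves these positions. Hence copies placed under the `let`-binders are weakenings of
one term. -/
theorem Exp.cost_subst (c : Costs) {G : List STy} {σ : STy} (t : Exp G σ) :
    ∀ {Γ Γ' : Ctx} (r : VMap G Γ) (ρ : Ren Γ Γ'),
      (t.cost c r).subst (Sub.ofRen ρ) = t.cost c (fun _ x => ρ (r x)) := by
  have hv1 : ∀ {Γ Γ' : Ctx} {σ τ : Ty} (ρ : Ren Γ Γ'),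
      (v1 (τ := σ) (τ₀ := τ)).subst (Sub.ofRen ρ.lift.lift) = v1 := fun _ => rfl
  induction t with
  | const n => intro Γ Γ' r ρ; exact congrArg (Tm.pair · .zero) (num_subst n _)
  | caseL t t₁ t₂ ih ih₁ ih₂ =>
    intro Γ Γ' r ρ
    refine (caseCost_subst ..).trans (caseCost_congr (ih r ρ) ?_ ?_)
    · rw [Sub.lift_ofRen]
      exact ih₁ r.wk _
    · rw [Sub.lift_ofRen, Sub.lift_ofRen, Sub.lift_ofRen]
      refine (ih₂ r.wk.lift.lift _).trans ?_
      rw [← VMap.wk_ren, ← VMap.lift_ren, ← VMap.lift_ren]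
      rfl
  | _ =>
    intro Γ Γ' r ρ
    simp only [Exp.cost, letIn, Tm.subst, Sub.lift_ofRen, VMap.lift_ren, VMap.wk_ren, num_subst,
      add_subst, *] <;> rfl

theorem Exp.cost_wk (c : Costs) {G : List STy} {σ : STy} (t : Exp G σ) {Γ : Ctx} {τ : Ty}
    (r : VMap G Γ) : (t.cost c r).wk (σ := τ) = t.cost c r.wk :=
  (Tm.rename_eq_subst _ _).trans (t.cost_subst c r up1)

/-- The map `r` extended by sending the most recent program variable to `y`. -/
def VMap.cons {G : List STy} {Γ : Ctx} {σ : STy} (r : VMap G Γ) (y : Var Γ σ.cv) :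
    VMap (σ :: G) Γ
  | _, .z => y
  | _, .s x => r x

section Costs

variable (c : Costs) {G : List STy} {Γ : Ctx} {Ψ : List (Fm Γ)} {σ τ : STy} (r : VMap G Γ)

theorem HOL.of_eq {τ : Ty} {t u : Tm Γ τ} (h : t = u) : HOL Ψ (.eq t u) := h ▸ .refl t

theorem HOL.letIn_eq {σ τ : Ty} (t : Tm Γ σ) (u : Tm (σ :: Γ) τ) :
    HOL Ψ (.eq (letIn t u) (u.subst (Sub.one t))) := .step (.beta _ _)

/-- Each `let` is a `β`-redex, so conversion may duplicate `T` and `U` freely. Here `U` occurs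
weakened because it sits under the binder of the first `let`. -/
theorem HOL.appCost_eq {σ τ : Ty} (n : ℕ) (T : Tm Γ (.prod (.arr σ (.prod τ .nat)) .nat))
    (U : Tm Γ (.prod σ .nat)) :
    HOL Ψ (.eq (letIn T (letIn U.wk (letIn (.app (.fst v1) (.fst v0))
        (.pair (.fst v0) (add (add (add (.snd v2) (.snd v1)) (.snd v0)) (num n))))))
      (.pair (.fst (.app (.fst T) (.fst U)))
        (add (add (add (.snd T) (.snd U)) (.snd (.app (.fst T) (.fst U)))) (num n)))) := by
  refine (HOL.letIn_eq _ _).trans ((HOL.step (.beta _ _)).trans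
    ((HOL.step (.beta _ _)).trans (.of_eq ?_)))
  simp

theorem HOL.iappCost_eq {τ : Ty} (n : ℕ) (T : Tm Γ (.prod (.arr .nat (.prod τ .nat)) .nat)) :
    HOL Ψ (.eq (letIn T (letIn (.app (.fst v0) .zero)
        (.pair (.fst v0) (add (add (.snd v1) (.snd v0)) (num n)))))
      (.pair (.fst (.app (.fst T) .zero))
        (add (add (.snd T) (.snd (.app (.fst T) .zero))) (num n)))) := by
  refine (HOL.letIn_eq _ _).trans ((HOL.step (.beta _ _)).trans (.of_eq ?_))
  simp

theorem HOL.consCost_eq {τ : Ty} (T : Tm Γ (.prod τ .nat)) (U : Tm Γ (.prod (.list τ) .nat)) :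
    HOL Ψ (.eq (letIn T (letIn U.wk (.pair (.cons (.fst v1) (.fst v0)) (add (.snd v1) (.snd v0)))))
      (.pair (.cons (.fst T) (.fst U)) (add (.snd T) (.snd U)))) := by
  refine (HOL.letIn_eq _ _).trans ((HOL.step (.beta _ _)).trans (.of_eq ?_))
  simp

/-- The scrutinee is only provably equal to `[]`, so it is replaced by congruence before the
`ι`-rule can fire. The cons case works in the same way. -/
theorem HOL.caseCost_nil {σ τ : Ty} (n : ℕ) {T : Tm Γ (.prod (.list σ) .nat)}
    (T₁ : Tm Γ (.prod τ .nat))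
    (T₂ : Tm (.list σ :: σ :: .prod (.list σ) .nat :: Γ) (.prod τ .nat))
    (h : HOL Ψ (.eq (.fst T) .nil)) :
    HOL Ψ (.eq (caseCost n T T₁.wk T₂)
      (.pair (.fst T₁) (add (add (.snd T) (.snd T₁)) (num n)))) := by
  refine (HOL.letIn_eq _ _).trans ((HOL.congrCaseList h).trans ((HOL.step (.caseListNil _ _)).trans
    ((HOL.step (.beta _ _)).trans (.of_eq ?_))))
  simp

theorem HOL.caseCost_cons {σ τ : Ty} (n : ℕ) {T : Tm Γ (.prod (.list σ) .nat)}
    (T₁ : Tm (.prod (.list σ) .nat :: Γ) (.prod τ .nat))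
    (T₂ : Tm (.list σ :: σ :: Γ) (.prod τ .nat)) {a : Tm Γ σ} {b : Tm Γ (.list σ)}
    (h : HOL Ψ (.eq (.fst T) (.cons a b))) :
    HOL Ψ (.eq (caseCost n T T₁ (T₂.rename (Ren.lift (Ren.lift up1))))
      (.pair (.fst (T₂.subst ((Sub.one a).cons b)))
        (add (add (.snd T) (.snd (T₂.subst ((Sub.one a).cons b)))) (num n)))) := by
  refine (HOL.letIn_eq _ _).trans ((HOL.congrCaseList h).trans ((HOL.step
    (.caseListCons _ _ _ _)).trans ((HOL.congrApp (.step (.beta _ _)) (.refl _)).trans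
      ((HOL.step (.beta _ _)).trans ((HOL.step (.beta _ _)).trans (.of_eq ?_))))))
  simp

theorem HOL.cost_app (t : Exp G (.arr σ τ)) (u : Exp G σ) :
    HOL Ψ (.eq ((Exp.app t u).cost c r)
      (.pair (.fst (.app (.fst (t.cost c r)) (.fst (u.cost c r))))
        (add (add (add (.snd (t.cost c r)) (.snd (u.cost c r)))
          (.snd (.app (.fst (t.cost c r)) (.fst (u.cost c r))))) (num c.cApp)))) := by
  rw [Exp.cost, ← Exp.cost_wk]
  exact HOL.appCost_eq ..

theorem HOL.cost_iapp (t : Exp G (.arr .nat σ)) :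
    HOL Ψ (.eq ((Exp.iapp t).cost c r)
      (.pair (.fst (.app (.fst (t.cost c r)) .zero))
        (add (add (.snd (t.cost c r)) (.snd (.app (.fst (t.cost c r)) .zero)))
          (num c.cIApp)))) := HOL.iappCost_eq ..

theorem HOL.cost_cons (t : Exp G σ) (u : Exp G (.list σ)) :
    HOL Ψ (.eq ((Exp.cons t u).cost c r)
      (.pair (.cons (.fst (t.cost c r)) (.fst (u.cost c r)))
        (add (.snd (t.cost c r)) (.snd (u.cost c r))))) := by
  rw [Exp.cost, ← Exp.cost_wk]
  exact HOL.consCost_eq ..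

variable (t : Exp G (.list σ)) (t₁ : Exp G τ) (t₂ : Exp (.list σ :: σ :: G) τ)

theorem HOL.cost_caseL_nil (h : HOL Ψ (.eq (.fst (t.cost c r)) .nil)) :
    HOL Ψ (.eq ((Exp.caseL t t₁ t₂).cost c r)
      (.pair (.fst (t₁.cost c r))
        (add (add (.snd (t.cost c r)) (.snd (t₁.cost c r))) (num c.cCase)))) := by
  rw [Exp.cost, ← Exp.cost_wk]
  exact HOL.caseCost_nil _ _ _ h

/-- Head and tail are required to be variables so that the reduced branch is again a translation of
`t₂`, at an extended placement, to which an induction hypothesis applies. -/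
theorem HOL.cost_caseL_cons (a : Var Γ σ.cv) (b : Var Γ (STy.list σ).cv)
    (h : HOL Ψ (.eq (.fst (t.cost c r)) (.cons (.var a) (.var b)))) :
    HOL Ψ (.eq ((Exp.caseL t t₁ t₂).cost c r)
      (.pair (.fst (t₂.cost c ((r.cons a).cons b)))
        (add (add (.snd (t.cost c r)) (.snd (t₂.cost c ((r.cons a).cons b))))
          (num c.cCase)))) := by
  -- Substituting variables for the two pattern variables is a renaming, so `Exp.cost_subst`
  -- applies.
  let ρ : Ren (.list σ.cv :: σ.cv :: Γ) Γ := fun _ x => match x with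
    | .z => b
    | .s .z => a
    | .s (.s x) => x
  have hρ : (Sub.one (.var a)).cons (.var b) = Sub.ofRen ρ := by
    funext τ x
    rcases x with _ | (_ | _) <;> rfl
  have h₁ : t₂.cost c ((r.cons a).cons b) =
      (t₂.cost c r.lift.lift).subst ((Sub.one (.var a)).cons (.var b)) := by
    rw [hρ]
    refine Eq.trans ?_ (Exp.cost_subst c t₂ r.lift.lift ρ).symm
    congr 1
    funext τ x
    rcases x with _ | (_ | _) <;> rfl
  have h₂ : t₂.cost c (VMap.wk r).lift.lift = (t₂.cost c r.lift.lift).rename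
      (Ren.lift (Ren.lift (up1 (σ := .prod (.list σ.cv) .nat)))) := by
    rw [Tm.rename_eq_subst]
    refine Eq.trans ?_ (Exp.cost_subst c t₂ r.lift.lift _).symm
    congr 1
    funext τ x
    rcases x with _ | (_ | _) <;> rfl
  rw [h₁]
  exact (HOL.of_eq (caseCost_congr rfl rfl h₂)).trans
    (HOL.caseCost_cons c.cCase (t₁.cost c r.wk) (t₂.cost c r.lift.lift) h)

end Costs

/-! ## Soundness of the unary typing rules in higher-order logic -/

theorem UEnv.lookup_wk {Δ : Ctx} {τ : Ty} {G : List STy} (Ω : UEnv Δ G) :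
    ∀ {σ : STy} (x : Var G σ), (Ω.wk (τ := τ)).lookup x = (Ω.lookup x).wk := by
  induction Ω with
  | nil => intro σ x; cases x
  | cons A Ω ih =>
    intro σ x
    cases x with
    | z => rfl
    | s x => exact ih x

section EnvSat

variable {Δ Γ : Ctx} {G : List STy} {Ψ : List (Fm Γ)} {s : Sub Δ Γ} {r : VMap G Γ} {Ω : UEnv Δ G}

/-- The predicates of the environment `Ω` are derivable from `Ψ` for the program variables. -/
def EnvSat (Ψ : List (Fm Γ)) (s : Sub Δ Γ) (r : VMap G Γ) (Ω : UEnv Δ G) : Prop :=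
  ∀ ⦃σ : STy⦄ (x : Var G σ), HOL Ψ ((Ω.lookup x).val s (.var (r x)))

theorem EnvSat.weaken (h : EnvSat Ψ s r Ω) {φ : Fm Γ} : EnvSat (φ :: Ψ) s r Ω :=
  fun _ x => (h x).weaken

theorem EnvSat.wk (h : EnvSat Ψ s r Ω) {ρ : Ty} : EnvSat (wkAll (σ := ρ) Ψ) s.wk r.wk Ω :=
  fun _ x => (h x).val_wk

theorem EnvSat.consIdx (h : EnvSat Ψ s r Ω) {ρ : Ty} (t : Tm Γ ρ) :
    EnvSat Ψ (s.cons t) r Ω.wk :=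
  fun _ x => (h x).cast (by rw [UEnv.lookup_wk, UTy.wk, UTy.val_tySubst]; rfl)

theorem EnvSat.cons (h : EnvSat Ψ s r Ω) {σ : STy} {A : UTy Δ σ} {y : Var Γ σ.cv}
    (hy : HOL Ψ (A.val s (.var y))) : EnvSat Ψ s (r.cons y) (.cons A Ω) := by
  intro τ x
  cases x with
  | z => exact hy
  | s x => exact h x

theorem VMap.lift_eq {σ : STy} (r : VMap G Γ) : r.lift (σ := σ) = r.wk.cons .z := by
  funext τ x; cases x <;> rfl

end EnvSat

theorem HOL.beta_wk {Γ : Ctx} {σ τ : Ty} (T : Tm (σ :: Γ) τ) {Ψ : List (Fm (σ :: Γ))} :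
    HOL Ψ (.eq (.app (Tm.lam T).wk v0) T) :=
  .step ((Step.beta _ _).cast (by simp))

theorem HOL.beta_wk_const {Γ : Ctx} {σ τ ρ ρ' : Ty} (T : Tm Γ τ) (u : Tm (ρ :: ρ' :: Γ) σ)
    {Ψ : List (Fm (ρ :: ρ' :: Γ))} :
    HOL Ψ (.eq (.app (Tm.lam T.wk).wk.wk u) T.wk.wk) :=
  .step ((Step.beta _ _).cast (by simp))

/-- The bounds on the cost of a term whose cost is the sum of two costs and a constant. -/
theorem HOL.exp_of_eq_pair_add {Δ Γ : Ctx} {Ψ : List (Fm Γ)} {s : Sub Δ Γ} {σ : STy}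
    {A : UTy Δ σ} {k₁ k₂ : Idx Δ} {l₁ l₂ : UB Δ} {n : ℕ} {x : Tm Γ σ.ce} {v : Tm Γ σ.cv}
    {a b : Tm Γ .nat} (e : HOL Ψ (.eq x (.pair v (add (add a b) (num n)))))
    (hv : HOL Ψ (A.val s v)) (hk₁ : HOL Ψ (.le (k₁.subst s) a))
    (hk₂ : HOL Ψ (.le (k₂.subst s) b)) (hl₁ : HOL Ψ (.leUB a (l₁.subst s)))
    (hl₂ : HOL Ψ (.leUB b (l₂.subst s))) :
    HOL Ψ (A.exp (add (add k₁ k₂) (num n)) ((l₁.add l₂).add (.fin (num n))) s x) := by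
  refine .exp_of_eq_pair e hv ?_ ?_
  · rw [add_subst, num_subst]
    exact (hk₁.add_le_add hk₂).add_le_add (.le_refl _)
  · rw [UB.add_subst, UB.add_subst]
    exact (hl₁.leUB_add hl₂).leUB_add (.le_of_eq (.of_eq (num_subst _ _).symm))

/-- The context, the interpretation `s` and the placement `r` are arbitrary because the rules for
`λ`, `Λ` and case analysis change them: a program or index variable introduced by the typing rule is
matched with whichever PCF variable the predicate supplies. -/
theorem UTyping.exp_sound {c : Costs} {Δ : Ctx} {G : List STy} {σ : STy} {Φ : List (Fm Δ)}
    {Ω : UEnv Δ G} {k : Idx Δ} {l : UB Δ} {t : Exp G σ} {A : UTy Δ σ}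
    (h : UTyping c Φ Ω k l t A) :
    ∀ {Γ : Ctx} {Ψ : List (Fm Γ)} {s : Sub Δ Γ} {r : VMap G Γ}, Sat Ψ s Φ → EnvSat Ψ s r Ω →
      HOL Ψ (A.exp k l s (t.cost c r)) := by
  induction h with
  | var x => intro Γ Ψ s r hs hr; exact .exp_pure (hr x)
  | const n => intro Γ Ψ s r hs hr; exact .exp_pure .topI
  | nil A =>
    intro Γ Ψ s r hs hr
    exact .exp_pure (.listU_zero_intro (.refl _))
  | lam _ ih =>
    intro Γ Ψ s r hs hr
    refine .exp_pure (.arr_intro (.exp_congr (ih hs.wk.weaken ?_) (HOL.beta_wk _).symm))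
    rw [VMap.lift_eq]
    exact hr.wk.weaken.cons (.ax (List.mem_cons_self ..))
  | @app Δ G σ τ Φ Ω A B k k₁ k₂ l l₁ l₂ t₁ t₂ _ _ ih₁ ih₂ =>
    intro Γ Ψ s r hs hr
    have h₁ := ih₁ hs hr
    have h₂ := ih₂ hs hr
    have h₃ := HOL.arr_elim h₁.exp_val h₂.exp_val
    -- Of the four summands, the costs of function and argument are grouped as one.
    refine .exp_of_eq_pair_add (HOL.cost_app c r t₁ t₂) h₃.exp_val
      (h₁.exp_lower.add_le_add h₂.exp_lower) h₃.exp_lower ?_ h₃.exp_upper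
    rw [UB.add_subst]
    exact h₁.exp_upper.leUB_add h₂.exp_upper
  | @ilam Δ G σ Φ Ω A k l t _ ih =>
    intro Γ Ψ s r hs hr
    -- The new index variable is the innermost `v0`. The translated body does not mention the dummy
    -- argument, so applying the abstraction returns the body itself.
    refine .exp_pure (.all_intro (.exp_congr (ih (hs.wk.weaken.wk.consIdx v0)
      (hr.wk.weaken.wk.consIdx v0)) (HOL.symm ?_)))
    rw [← Exp.cost_wk, ← Exp.cost_wk, ← Exp.cost_wk]
    exact HOL.beta_wk_const _ _
  | @iapp Δ G σ Φ Ω A k l k' l' t _ J ih =>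
    intro Γ Ψ s r hs hr
    have h₁ := ih hs hr
    -- The term is applied to the dummy `0`; the logical index is instantiated with `J`.
    have h₂ := HOL.all_elim h₁.exp_val .zero (J.subst s)
    have e : (Sub.one J).comp s = s.cons (J.subst s) := by simp
    exact .exp_of_eq_pair_add (HOL.cost_iapp c r t)
      (h₂.exp_val.cast (by rw [UTy.val_tySubst, e]; rfl)) h₁.exp_lower
      (h₂.exp_lower.cast (by rw [Tm.subst_subst, e]; rfl)) h₁.exp_upper
      (h₂.exp_upper.cast (by rw [UB.subst_subst, e]; rfl))
  | @cons Δ G σ Φ Ω A I k₁ k₂ l₁ l₂ t₁ t₂ _ _ ih₁ ih₂ =>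
    intro Γ Ψ s r hs hr
    have h₁ := ih₁ hs hr
    have h₂ := ih₂ hs hr
    refine .exp_of_eq_pair (HOL.cost_cons c r t₁ t₂) ?_ ?_ ?_
    · exact .listU_succ_intro _ _ (.refl _) (h₁.exp_val.cast (by simp [UTy.val_subst]))
        h₂.exp_val
    · exact h₁.exp_lower.add_le_add h₂.exp_lower
    · rw [UB.add_subst]
      exact h₁.exp_upper.leUB_add h₂.exp_upper
  | @caseL Δ G σ τ Φ Ω A B I k k' l l' t t₁ t₂ _ _ _ ih ih₁ ih₂ =>
    intro Γ Ψ s r hs hr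
    have h := ih hs hr
    -- The split is on the size, not on the list: it supplies the index assumption of each branch,
    -- and `listU` then determines the shape of the list.
    refine .natCases (I.subst s) ?_ ?_
    · have hI := HOL.ax (List.mem_cons_self (a := Fm.eq (I.subst s) .zero) (l := Ψ))
      have h₀ := ih hs.weaken (hr.weaken (φ := Fm.eq (I.subst s) .zero))
      have h₁ := ih₁ (hs.weaken.cons hI) hr.weaken
      exact .exp_of_eq_pair_add (HOL.cost_caseL_nil c r t t₁ t₂
        (.listU_zero_elim (h₀.exp_val.listU_congr hI (.refl _)))) h₁.exp_val h₀.exp_lower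
        h₁.exp_lower h₀.exp_upper h₁.exp_upper
    · have hI : HOL (.eq (I.subst s).wk (.succ v0) :: wkAll Ψ)
          (.eq (I.subst s.wk) (.succ (v0 (Γ := Γ)))) := by
        rw [Sub.wk_eq, ← Tm.subst_subst, ← Tm.wk_eq]
        exact .ax (List.mem_cons_self ..)
      refine .listU_succ_elim (HOL.listU_congr (h.exp_wk.weaken).exp_val hI (.refl _)) ?_
      rw [UTy.exp_subst, UTy.exp_subst, Exp.cost_subst, Exp.cost_subst]
      set Ψ' := Fm.listU _ _ _ :: _
      -- Three variables are now in scope: the predecessor of the size (`v2`), which interprets the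
      -- fresh index variable, then the head (`v1`) and the tail (`v0`).
      have hs' : Sat Ψ' (s.wk.wk.wk.cons v2) (.eq I.wk (.succ v0) :: wkAll Φ) :=
        (hs.wk.weaken.wk.wk.weaken.weaken.weaken.consIdx _).cons (.ax (by simp [wkAll]))
      have hr' : EnvSat Ψ' (s.wk.wk.wk.cons v2) ((r.wk.wk.wk.cons (σ := σ) (.s .z)).cons
          (σ := .list σ) .z) (.cons (.list A.wk v0) (.cons A.wk Ω.wk)) := by
        refine ((hr.wk.weaken.wk.wk.weaken.weaken.weaken.consIdx _).cons ?_).cons ?_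
        · refine (HOL.ax (List.mem_cons_of_mem _ (List.mem_cons_self ..))).cast ?_
          simp [UTy.val_subst, UTy.val_tySubst, UTy.wk]
        · refine (HOL.ax (List.mem_cons_self ..)).cast ?_
          simp [UTy.val, UTy.val_subst, UTy.val_tySubst, UTy.wk]
          rfl
      have h₀ : HOL Ψ' ((UTy.list A I).exp k l s.wk.wk.wk (t.cost c r.wk.wk.wk)) :=
        ih hs.wk.weaken.wk.wk.weaken.weaken.weaken hr.wk.weaken.wk.wk.weaken.weaken.weaken
      have h₂ : HOL Ψ' (B.exp k' l' s.wk.wk.wk _) := (ih₂ hs' hr').cast (by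
        rw [UTy.wk, UB.wk, Tm.wk_eq, UTy.exp_tySubst]; rfl)
      refine HOL.cast (HOL.exp_of_eq_pair_add (s := s.wk.wk.wk) (HOL.cost_caseL_cons c
        r.wk.wk.wk t t₁ t₂ (.s .z) .z ?_) h₂.exp_val h₀.exp_lower h₂.exp_lower h₀.exp_upper
          h₂.exp_upper) ?_
      · rw [← Exp.cost_wk, ← Exp.cost_wk, ← Exp.cost_wk]
        exact .ax (List.mem_cons_of_mem _ (List.mem_cons_of_mem _ (List.mem_cons_self ..)))
      -- The goal was weakened once by the split on the size and twice by unfolding `listU`; this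
      -- agrees with three single weakenings.
      · rw [Sub.wk_eq, Sub.wk_eq, Sub.wk_eq, Sub.comp_assoc (s.comp _)]
        rfl
  | sub _ hA hk hl ih =>
    intro Γ Ψ s r hs hr
    exact HOL.exp_mono (fun y => hA.val_mono hs y) hs hk hl (ih hs hr)
  | split hC _ _ ih ih' =>
    intro Γ Ψ s r hs hr
    exact .orE (hC.substAll hs) (ih (hs.weaken.cons (.ax (List.mem_cons_self ..))) hr.weaken)
      (ih' (hs.weaken.cons (.ax (List.mem_cons_self ..))) hr.weaken)
  | contra hC => intro Γ Ψ s r hs hr; exact .botE _ (hC.substAll hs)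

/-! ## From higher-order logic to unary higher-order logic -/

/-- Terms that satisfy the trivial assertion in unary higher-order logic. -/
def Total {Γ : Ctx} {σ : Ty} (t : Tm Γ σ) : Prop := ∀ Ψ : List (Fm Γ), UHOL Ψ t .top

/-- The premise of subsumption concerns the term itself and not an arbitrary `r`, so starting from
`⊤` it asks for nothing beyond the HOL fact. -/
theorem UHOL.of_total {Γ : Ctx} {σ : Ty} {t : Tm Γ σ} (ht : Total t) {Ψ : List (Fm Γ)}
    {φ : Fm (σ :: Γ)} (h : HOL Ψ (φ.inst t)) : UHOL Ψ t φ := .sub (ht Ψ) (.impI h.weaken)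

section Total

variable {Γ : Ctx} {σ τ : Ty}

theorem Total.var (x : Var Γ σ) : Total (.var x) := fun _ => .var .topI
theorem Total.zero : Total (.zero (Γ := Γ)) := fun _ => .zero .topI
theorem Total.nil : Total (.nil (Γ := Γ) (τ := τ)) := fun _ => .nil .topI

theorem Total.succ {t : Tm Γ .nat} (h : Total t) : Total (.succ t) :=
  fun Ψ => .succ (h Ψ) (.allI (.impI .topI))

theorem Total.cons {t : Tm Γ τ} {u : Tm Γ (.list τ)} (ht : Total t) (hu : Total u) :
    Total (.cons t u) := fun Ψ => .cons (ht Ψ) (hu Ψ) (.allI (.allI (.impI (.impI .topI))))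

theorem Total.pair {t : Tm Γ σ} {u : Tm Γ τ} (ht : Total t) (hu : Total u) :
    Total (.pair t u) := fun Ψ => .pair (ht Ψ) (hu Ψ) (.allI (.allI (.impI (.impI .topI))))

theorem Total.fst {t : Tm Γ (.prod σ τ)} (h : Total t) : Total (.fst t) :=
  fun Ψ => .proj1 (h Ψ)

theorem Total.snd {t : Tm Γ (.prod σ τ)} (h : Total t) : Total (.snd t) :=
  fun Ψ => .proj2 (h Ψ)

theorem Total.lam {t : Tm (σ :: Γ) τ} (h : Total t) : Total (.lam t) :=
  fun _ => .sub (.abs (φ' := .top) (φ := .top) (h _)) (.impI .topI)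

/-- The application rule wants a function specification; with trivial pre- and postcondition HOL
proves it of any function, so `UHOL.of_total` supplies it. -/
theorem Total.app {t : Tm Γ (.arr σ τ)} {u : Tm Γ σ} (ht : Total t) (hu : Total u) :
    Total (.app t u) := fun _ =>
  .app (φ' := .top) (φ := .top) (.of_total ht (.allI (.impI .topI))) (hu _)

theorem Total.letIn {t : Tm Γ σ} {u : Tm (σ :: Γ) τ} (ht : Total t) (hu : Total u) :
    Total (letIn t u) := hu.lam.app ht

theorem Total.caseNat {t : Tm Γ .nat} {u : Tm Γ τ} {v : Tm Γ (.arr .nat τ)} (hu : Total u)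
    (hv : Total v) : Total (.caseNat t u v) := fun _ =>
  .natCase (hu _) (.of_total hv (.allI (.impI .topI)))

theorem Total.caseList {t : Tm Γ (.list σ)} {u : Tm Γ τ} {v : Tm Γ (.arr σ (.arr (.list σ) τ))}
    (hu : Total u) (hv : Total v) : Total (.caseList t u v) := fun _ =>
  .listCase (hu _) (.of_total hv (.allI (.allI (.impI .topI))))

theorem Total.letrec (hI : Ind σ) {e : Tm (σ :: .arr σ τ :: Γ) τ} (hw : WDef e) (he : Total e) :
    Total (.letrec hI e) := fun _ =>
  .sub (.letrec (φ' := .top) (φ := .top) hI hw (he _)) (.impI .topI)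

/-- Addition is the only recursive definition in translated terms, so this is where the guard
condition of the UHOL `letrec` rule is checked. -/
theorem Total.add {t u : Tm Γ .nat} (ht : Total t) (hu : Total u) : Total (add t u) := by
  refine .app (.app (.lam (.letrec _ ?_ ?_)) ht) hu
  · exact .caseNatSmall (.inl rfl) (.var (fun h => nomatch h)) (.succ (.call rfl rfl))
  · exact .caseNat (.var _) (.lam (.succ (.app (.var _) (.var _))))

theorem Total.num (n : ℕ) : Total (num (Γ := Γ) n) := by
  induction n with
  | zero => exact .zero
  | succ n ih => exact .succ ih

end Total

/-- No typing derivation is needed: simple typing suffices for the trivial specification. -/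
theorem Exp.cost_total (c : Costs) {G : List STy} {σ : STy} (t : Exp G σ) :
    ∀ {Γ : Ctx} (r : VMap G Γ), Total (t.cost c r) := by
  induction t with
  | var x => intro Γ r; exact .pair (.var _) .zero
  | const n => intro Γ r; exact .pair (.num n) .zero
  | lam t ih => intro Γ r; exact .pair (.lam (ih _)) .zero
  | app t u iht ihu =>
    intro Γ r
    exact .letIn (iht r) (.letIn (ihu _) (.letIn (.app (.fst (.var _)) (.fst (.var _)))
      (.pair (.fst (.var _)) (.add (.add (.add (.snd (.var _)) (.snd (.var _))) (.snd (.var _)))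
        (.num _)))))
  | ilam t ih => intro Γ r; exact .pair (.lam (ih _)) .zero
  | iapp t ih =>
    intro Γ r
    exact .letIn (ih r) (.letIn (.app (.fst (.var _)) .zero)
      (.pair (.fst (.var _)) (.add (.add (.snd (.var _)) (.snd (.var _))) (.num _))))
  | nil => intro Γ r; exact .pair .nil .zero
  | cons t u iht ihu =>
    intro Γ r
    exact .letIn (iht r) (.letIn (ihu _) (.pair (.cons (.fst (.var _)) (.fst (.var _)))
      (.add (.snd (.var _)) (.snd (.var _)))))
  | caseL t t₁ t₂ ih ih₁ ih₂ =>
    intro Γ r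
    exact .letIn (ih r) (.caseList
      (.letIn (ih₁ _) (.pair (.fst (.var _)) (.add (.add (.snd (.var _)) (.snd (.var _)))
        (.num _))))
      (.lam (.lam (.letIn (ih₂ _) (.pair (.fst (.var _))
        (.add (.add (.snd (.var _)) (.snd (.var _))) (.num _)))))))

theorem UEnv.val_mem_fms {Δ Γ : Ctx} {G : List STy} (Ω : UEnv Δ G) (s : Sub Δ Γ) :
    ∀ (r : VMap G Γ) {σ : STy} (x : Var G σ),
      (Ω.lookup x).val s (.var (r x)) ∈ Ω.fms s r := by
  induction Ω with
  | nil => intro r σ x; cases x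
  | cons A Ω ih =>
    intro r σ x
    cases x with
    | z => exact List.mem_cons_self ..
    | s x => exact List.mem_cons_of_mem _ (ih (fun _ x => r (.s x)) x)

end RelCost

/-! ### The theorem, at the canonical placement of the variables -/

theorem mainTheorem9 (c : RelCost.Costs) (n : ℕ) {G : List RelCost.STy} {σ : RelCost.STy}
    (Φ : List (RelCost.Fm (List.replicate n RelCost.Ty.nat)))
    (Ω : RelCost.UEnv (List.replicate n RelCost.Ty.nat) G)
    (k : RelCost.Idx (List.replicate n RelCost.Ty.nat))
    (l : RelCost.UB (List.replicate n RelCost.Ty.nat))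
    (t : RelCost.Exp G σ) (A : RelCost.UTy (List.replicate n RelCost.Ty.nat) σ)
    (h : RelCost.UTyping c Φ Ω k l t A) :
    RelCost.UHOL
      (Φ.map (fun φ => φ.rename (RelCost.idxVar (G := G))) ++
        Ω.fms (RelCost.Sub.ofRen (RelCost.idxVar (G := G))) RelCost.progVar)
      (t.cost c (RelCost.progVar (G := G) (Δ := List.replicate n RelCost.Ty.nat)))
      (A.exp k l (RelCost.Sub.ofRen (RelCost.idxVar (G := G))).wk RelCost.v0) := by
  -- With the canonical embeddings for `s` and `r`, the required instances of `Φ` and `⌊Ω⌋` are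
  -- exactly members of the hypotheses.
  refine .of_total (t.cost_total c _) ((h.exp_sound (r := RelCost.progVar)
    (s := RelCost.Sub.ofRen RelCost.idxVar)
    (fun φ hφ => ?_) (fun σ x => ?_)).cast ?_)
  · exact .ax (List.mem_append_left _ (List.mem_map.2 ⟨φ, hφ, rfl⟩))
  · exact .ax (List.mem_append_right _ (Ω.val_mem_fms _ _ x))
  · simp [RelCost.UTy.exp_subst]
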